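/- Let $b>1$. On $\mathfrak{so}(4)^*\cong\mathbb{R}^6$ with coordinates $\boldsymbol L=(\ell_{12},\ell_{13},\ell_{14},\ell_{23},\ell_{24},\ell_{34})$ consider the Lie–Poisson bracket $\{f,g\}=(\nabla f)^T B_{\boldsymbol L}\nabla g$ with structure matrix $$B_{\boldsymbol L}=\begin{pmatrix}0&\ell_{23}&\ell_{24}&-\ell_{13}&-\ell_{14}&0\\-\ell_{23}&0&\ell_{34}&\ell_{12}&0&-\ell_{14}\\-\ell_{24}&-\ell_{34}&0&0&\ell_{12}&\ell_{13}\\ \ell_{13}&-\ell_{12}&0&0&\ell_{34}&-\ell_{24}\\ \ell_{14}&0&-\ell_{12}&-\ell_{34}&0&\ell_{23}\\0&\ell_{14}&-\ell_{13}&\ell_{24}&-\ell_{23}&0\end{pmatrix},$$ and its symplectic leaf $$M=\Big\{\textstyle\sum_{i<j}\ell_{ij}^2=1,\ \ \ell_{12}\ell_{34}-\ell_{13}\ell_{24}+\ell_{14}\ell_{23}=0\Big\}=\{|\boldsymbol X|=|\boldsymbol Y|=\tfrac12\}\cong S^2\times S^2,$$ where $\boldsymbol X=\frac12(\ell_{12}+\ell_{34},\ell_{13}-\ell_{24},\ell_{14}+\ell_{23})$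 and $\boldsymbol Y=\frac12(\ell_{12}-\ell_{34},-\ell_{13}-\ell_{24},\ell_{14}-\ell_{23})$. Let $G_{pro}=b\ell_{12}^2+b\ell_{13}^2+\ell_{14}^2$. The reduced prolate system is the pair $(\ell_{23},G_{pro})$ on $M$. Then: 1. $\ell_{23}$ generates a global $S^1$ action on $M$: its Hamiltonian flow on $M$ is the flow of a continuous effective action of the circle $\mathbb R/2\pi\mathbb Z$. 2. Every singular point of $(\ell_{23},G_{pro}):M\to\mathbb R^2$ is non-degenerate, and is either of purely elliptic type (elliptic–regular or elliptic–elliptic) or a focus-focus point. 3. The set of values of $(\ell_{23},G_{pro})$ at focus-focus points is exactly $\{(0,1)\}$, and the fibre $\{p\in M:(\ell_{23},G_{pro})(p)=(0,1)\}$ is a doubly pinched torus: it is homeomorphic to the quotient of $S^1\times S^1$ obtained by collapsing each of the two circles $\{1\}\times S^1$ and $\{-1\}\times S^1$ to a point, by a homeomorphism under which the two pinch points correspond to the focus-focus points. 4. Hence $(\ell_{23},G_{pro})$ is a generalised semi-toric system on $M$. That is, $M$ is a connected symplectic four-manifold; $\ell_{23}$ and $G_{pro}$ are smooth, Poisson-commute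 on $M$ and have linearly independent differentials almost everywhere on $M$; $\ell_{23}$ is proper on $M$ and generates a global effective $S^1$ action; and all singular points are non-degenerate with only elliptic and focus-focus components (several focus-focus points may lie in one level set). Here a singular point $p$ is a point where the rank $r$ of the differential of $(J,H)=(\ell_{23},G_{pro})$ on $T_pM$ is less than $2$. Put $K=\ker dJ\cap\ker dH\subset T_pM$ and $L=\mathrm{span}(X_J,X_H)(p)\subset K$, where $X_f=B_{\boldsymbol L}\nabla f$. For each combination $f=sJ+tH$ with $X_f(p)=0$, the linearisation of $X_f$ at $p$ induces an operator on the $(4-2r)$-dimensional space $K/L$. The point $p$ is non-degenerate if these operators form a space of dimension $2-r$ and one of them, called regular, has $4-2r$ distinct complex eigenvalues. It is of elliptic type if the eigenvalues of a regular operator are purely imaginary, and focus-focus if $r=0$ and the eigenvalues of a regular operator are $\pm\alpha\pm i\beta$ with $\alpha,\beta\neq0$ real. -/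

import Mathlib

open scoped ContDiff

/-! ## Integrable systems with two degrees of freedom on symplectic submanifolds of a Poisson space

A Poisson structure on `ℝⁿ` is given by its structure matrix `B`, so that
`{f, g} = (∇f)ᵀ B ∇g` and the Hamiltonian vector field of `f` is `B ∇f`. -/

namespace PoissonSystem

/-- The space `ℝⁿ` with its Euclidean inner product. -/
abbrev Vec (n : ℕ) : Type := EuclideanSpace ℝ (Fin n)

/-- A field of `n × n` matrices on `ℝⁿ`. -/
abbrev MatField (n : ℕ) : Type := Vec n → Matrix (Fin n) (Fin n) ℝ

/-- The Hamiltonian vector field `X_f = B ∇f`. -/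
noncomputable def hamVF {n : ℕ} (B : MatField n) (f : Vec n → ℝ) (p : Vec n) : Vec n :=
  Matrix.toEuclideanLin (B p) (gradient f p)

/-- The bracket `{f, g} = (∇f)ᵀ B ∇g`. -/
noncomputable def bracket {n : ℕ} (B : MatField n) (f g : Vec n → ℝ) (p : Vec n) : ℝ :=
  inner ℝ (gradient f p) (hamVF B g p)

/-- `B` is the structure matrix of a smooth Poisson bracket: it is smooth and antisymmetric, and
the Jacobi identity `{xᵢ, {xⱼ, xₖ}} + {xⱼ, {xₖ, xᵢ}} + {xₖ, {xᵢ, xⱼ}} = 0` holds for the coordinate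
functions, for which `{xⱼ, xₖ} = Bⱼₖ`. -/
structure IsPoisson {n : ℕ} (B : MatField n) : Prop where
  smooth : ∀ i j, ContDiff ℝ ∞ (fun p => B p i j)
  antisymm : ∀ p i j, B p i j = - B p j i
  jacobi : ∀ p i j k,
    bracket B (fun q => q i) (fun q => B q j k) p
      + bracket B (fun q => q j) (fun q => B q k i) p
      + bracket B (fun q => q k) (fun q => B q i j) p = 0

/-- The characteristic subspace `{X_f(p)} = range B(p)`. -/
noncomputable def charSpace {n : ℕ} (B : MatField n) (p : Vec n) : Submodule ℝ (Vec n) :=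
  LinearMap.range (Matrix.toEuclideanLin (B p))

/-- `M` is a connected embedded submanifold of dimension `d` whose tangent space at each point `p`
is the characteristic subspace at `p`; thus the Poisson structure makes `M` a symplectic manifold,
with `ω(X_f, X_g) = {f, g}`. -/
structure IsSymplecticManifold {n : ℕ} (B : MatField n) (M : Set (Vec n)) (d : ℕ) : Prop where
  poisson : IsPoisson B
  connected : IsConnected M
  submanifold : ∀ p ∈ M, ∃ k : ℕ, k + d = n ∧ ∃ U : Set (Vec n), IsOpen U ∧ p ∈ U ∧
    ∃ Φ : Vec n → Vec k, ContDiffOn ℝ ∞ Φ U ∧ M ∩ U = {q ∈ U | Φ q = 0} ∧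
      Function.Surjective (fderiv ℝ Φ p) ∧
      LinearMap.ker (fderiv ℝ Φ p : Vec n →ₗ[ℝ] Vec k) = charSpace B p

/-- `f` generates a global circle action on `M`: there is an effective continuous action of the
circle group on `M` whose orbits `t ↦ exp(it) • p` are the integral curves of `X_f`; that is, the
Hamiltonian flow of `f` on `M` is complete and periodic with minimal common period `2π`. -/
def GeneratesCircleAction {n : ℕ} (B : MatField n) (M : Set (Vec n)) (f : Vec n → ℝ) : Prop :=
  ∃ φ : Circle → M → M,
    Continuous (fun q : Circle × M => φ q.1 q.2) ∧
    (∀ p, φ 1 p = p) ∧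
    (∀ z w p, φ (z * w) p = φ z (φ w p)) ∧
    (∀ z, (∀ p, φ z p = p) → z = 1) ∧
    ∀ (p : M) (t : ℝ), HasDerivAt (fun s : ℝ => (φ (Circle.exp s) p : Vec n))
      (hamVF B f (φ (Circle.exp t) p)) t

section Singularities

variable {n : ℕ} (B : MatField n) (J H : Vec n → ℝ) (p : Vec n)

/-- The span `L` of the Hamiltonian vector fields of `J` and `H` at `p`. -/
noncomputable def orbitSpace : Submodule ℝ (Vec n) :=
  Submodule.span ℝ {hamVF B J p, hamVF B H p}

/-- The rank at `p` of the differential of the momentum map `(J, H)` on the symplectic manifold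
through `p`, which is the dimension of the span of the two Hamiltonian vector fields. -/
noncomputable def rank : ℕ := Module.finrank ℝ (orbitSpace B J H p)

/-- The common kernel `K` of `dJ` and `dH` in the tangent space at `p` of the symplectic manifold
through `p`. It is the symplectic orthogonal complement of `L`. -/
noncomputable def commonKernel : Submodule ℝ (Vec n) :=
  charSpace B p ⊓ LinearMap.ker (fderiv ℝ J p : Vec n →ₗ[ℝ] ℝ)
    ⊓ LinearMap.ker (fderiv ℝ H p : Vec n →ₗ[ℝ] ℝ)

/-- The combination `s J + t H`. -/
def comb (s t : ℝ) : Vec n → ℝ := fun q => s * J q + t * H q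

/-- The linearisation at `p` of the Hamiltonian vector field of `s J + t H`. It is used only where
that vector field vanishes at `p`; on the tangent space of the symplectic manifold it is then
`ω⁻¹ d²(s J + t H)`. -/
noncomputable def linearisation (s t : ℝ) : Vec n →L[ℝ] Vec n :=
  fderiv ℝ (hamVF B (comb J H s t)) p

/-- `z` is a complex eigenvalue, with eigenvector the class of `u + i v`, of the operator induced
on `K / L` by the linearisation of the Hamiltonian vector field of `s J + t H` at `p`. -/
def IsTransverseEigenvalue (s t : ℝ) (z : ℂ) : Prop :=
  ∃ u ∈ commonKernel B J H p, ∃ v ∈ commonKernel B J H p,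
    ¬ (u ∈ orbitSpace B J H p ∧ v ∈ orbitSpace B J H p) ∧
    linearisation B J H p s t u - (z.re • u - z.im • v) ∈ orbitSpace B J H p ∧
    linearisation B J H p s t v - (z.im • u + z.re • v) ∈ orbitSpace B J H p

/-- `s J + t H` is regular at `p`: `p` is a critical point of it, and the operator it induces on
`K / L`, a space of dimension `4 - 2 * rank`, has that many distinct eigenvalues. -/
def IsRegularComb (s t : ℝ) : Prop :=
  hamVF B (comb J H s t) p = 0 ∧
    {z : ℂ | IsTransverseEigenvalue B J H p s t z}.encard + 2 * (rank B J H p : ℕ∞) = 4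

/-- The point `p` is non-degenerate for `(J, H)` on the four-dimensional symplectic manifold through
`p`: the operators induced on `K / L` by the combinations `s J + t H` that are critical at `p` form
a Cartan subalgebra of the symplectic Lie algebra of `K / L`, that is, they have the full dimension
`2 - rank`, and among them there is one with simple spectrum. -/
def IsNondegenerate : Prop :=
  (∀ s t : ℝ, hamVF B (comb J H s t) p = 0 →
    (∀ u ∈ commonKernel B J H p, linearisation B J H p s t u ∈ orbitSpace B J H p) →
      s = 0 ∧ t = 0) ∧
  ∃ s t : ℝ, IsRegularComb B J H p s t

/-- `p` is a singular point of the momentum map `(J, H)`. -/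
def IsSingular : Prop := rank B J H p < 2

/-- `p` is a non-degenerate singular point with only elliptic components (elliptic-regular if the
rank is one, elliptic-elliptic if it is zero): the eigenvalues of a regular combination are purely
imaginary. -/
def IsEllipticPoint : Prop :=
  IsSingular B J H p ∧ IsNondegenerate B J H p ∧
    ∃ s t : ℝ, IsRegularComb B J H p s t ∧
      ∀ z : ℂ, IsTransverseEigenvalue B J H p s t z → z.re = 0

/-- `p` is a focus-focus point: a non-degenerate singular point of rank zero where the eigenvalues
of a regular combination are `±α ± iβ` with `α, β ≠ 0`. -/
def IsFocusFocusPoint : Prop :=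
  rank B J H p = 0 ∧ IsNondegenerate B J H p ∧
    ∃ s t : ℝ, IsRegularComb B J H p s t ∧ ∃ α β : ℝ, α ≠ 0 ∧ β ≠ 0 ∧
      ∀ z : ℂ, IsTransverseEigenvalue B J H p s t z ↔
        (z.re = α ∨ z.re = -α) ∧ (z.im = β ∨ z.im = -β)

end Singularities

/-- `(J, H)` is a Liouville integrable system on the symplectic four-manifold `M`: `J` and `H` are
smooth, commute on `M`, and have independent differentials almost everywhere on `M` (with respect
to the four-dimensional Hausdorff measure, whose null sets in `M` are those of the Liouville
volume). -/
structure IsIntegrableSystem {n : ℕ} (B : MatField n) (M : Set (Vec n)) (J H : Vec n → ℝ) :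
    Prop where
  symplectic : IsSymplecticManifold B M 4
  smooth_J : ContDiff ℝ ∞ J
  smooth_H : ContDiff ℝ ∞ H
  commute : ∀ p ∈ M, bracket B J H p = 0
  independent : MeasureTheory.Measure.hausdorffMeasure (4 : ℝ) {p ∈ M | IsSingular B J H p} = 0

/-- `(J, H)` is a generalised semi-toric system on the connected symplectic four-manifold `M`: it is
an integrable system, `J` is proper and generates a global effective circle action, and all singular
points of `(J, H)` are non-degenerate with elliptic and focus-focus components only. The word
`generalised` refers to the fact that several focus-focus points may share a level set. -/
structure IsGeneralisedSemitoric {n : ℕ} (B : MatField n) (M : Set (Vec n)) (J H : Vec n → ℝ) :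
    Prop where
  integrable : IsIntegrableSystem B M J H
  proper : ∀ C : Set ℝ, IsCompact C → IsCompact (M ∩ J ⁻¹' C)
  circleAction : GeneratesCircleAction B M J
  singularities : ∀ p ∈ M, IsSingular B J H p →
    IsNondegenerate B J H p ∧ (IsEllipticPoint B J H p ∨ IsFocusFocusPoint B J H p)

/-- The equivalence relation on the torus `S¹ × S¹` which collapses each of the two parallel circles
`{1} × S¹` and `{-1} × S¹` to a point. -/
def pinchSetoid : Setoid (Circle × Circle) where
  r x y := x = y ∨ (x.1 = y.1 ∧ x.1 ^ 2 = 1)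
  iseqv :=
    { refl := fun _ => Or.inl rfl
      symm := by
        rintro x y (h | ⟨h, h'⟩)
        · exact Or.inl h.symm
        · exact Or.inr ⟨h.symm, h ▸ h'⟩
      trans := by
        rintro x y z (h | ⟨h, h'⟩) (k | ⟨k, k'⟩)
        · exact Or.inl (h.trans k)
        · exact Or.inr ⟨h ▸ k, h ▸ k'⟩
        · exact Or.inr ⟨k ▸ h, h'⟩
        · exact Or.inr ⟨h.trans k, h'⟩ }

/-- The doubly pinched torus, with the quotient topology. -/
abbrev DoublyPinchedTorus : Type := Quotient pinchSetoid

/-- The two pinch points of the doubly pinched torus. -/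
def pinchPoints : Set DoublyPinchedTorus :=
  {x | ∃ z w : Circle, z ^ 2 = 1 ∧ x = Quotient.mk pinchSetoid (z, w)}

end PoissonSystem

/-! ## The reduced prolate system

Coordinates on `so(4)* = ℝ⁶` are `L = (ℓ₁₂, ℓ₁₃, ℓ₁₄, ℓ₂₃, ℓ₂₄, ℓ₃₄)`, with indices `0, …, 5`. -/

namespace Prolate

open PoissonSystem

/-- The structure matrix of the Lie-Poisson bracket of `so(4)*`. -/
def structureMatrix : MatField 6 := fun L =>
  !![    0,  L 3,  L 4, -L 1, -L 2,    0;
      -L 3,    0,  L 5,  L 0,    0, -L 2;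
      -L 4, -L 5,    0,    0,  L 0,  L 1;
       L 1, -L 0,    0,    0,  L 5, -L 4;
       L 2,    0, -L 0, -L 5,    0,  L 3;
         0,  L 2, -L 1,  L 4, -L 3,    0]

/-- The vector `X = ½ (ℓ₁₂ + ℓ₃₄, ℓ₁₃ - ℓ₂₄, ℓ₁₄ + ℓ₂₃)`. -/
noncomputable def vecX (L : Vec 6) : Vec 3 :=
  !₂[(L 0 + L 5) / 2, (L 1 - L 4) / 2, (L 2 + L 3) / 2]

/-- The vector `Y = ½ (ℓ₁₂ - ℓ₃₄, -ℓ₁₃ - ℓ₂₄, ℓ₁₄ - ℓ₂₃)`. -/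
noncomputable def vecY (L : Vec 6) : Vec 3 :=
  !₂[(L 0 - L 5) / 2, -(L 1 + L 4) / 2, (L 2 - L 3) / 2]

/-- The reduced phase space `S² × S²` at energy `2h = 1`: the product of the spheres
`|X|² = |Y|² = h/2 = 1/4` in the linear coordinates `(X, Y)` on `ℝ⁶`. -/
def phaseSpace : Set (Vec 6) :=
  {L | vecX L ∈ Metric.sphere (0 : Vec 3) (1 / 2) ∧ vecY L ∈ Metric.sphere (0 : Vec 3) (1 / 2)}

/-- The reduced phase space is the level set `∑ ℓᵢⱼ² = 2h = 1`,
`ℓ₁₂ ℓ₃₄ - ℓ₁₃ ℓ₂₄ + ℓ₁₄ ℓ₂₃ = 0` of the two Casimirs. -/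
theorem mem_phaseSpace_iff (L : Vec 6) :
    L ∈ phaseSpace ↔
      L 0 ^ 2 + L 1 ^ 2 + L 2 ^ 2 + L 3 ^ 2 + L 4 ^ 2 + L 5 ^ 2 = 1 ∧
        L 0 * L 5 - L 1 * L 4 + L 2 * L 3 = 0 := by
  have key : ∀ v : Vec 3, v ∈ Metric.sphere (0 : Vec 3) (1 / 2) ↔
      v 0 ^ 2 + v 1 ^ 2 + v 2 ^ 2 = 1 / 4 := by
    intro v
    rw [mem_sphere_zero_iff_norm, ← sq_eq_sq₀ (norm_nonneg v) (by norm_num),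
      EuclideanSpace.real_norm_sq_eq, Fin.sum_univ_three]
    norm_num
  simp only [phaseSpace, Set.mem_ofPred_eq, key]
  simp [vecX, vecY]
  constructor
  · rintro ⟨h1, h2⟩
    constructor <;> nlinarith
  · rintro ⟨h1, h2⟩
    constructor <;> nlinarith

/-- The integral `ℓ₂₃`. -/
def ell23 (L : Vec 6) : ℝ := L 3

/-- The integral `G_pro = b ℓ₁₂² + b ℓ₁₃² + ℓ₁₄²`. -/
def gPro (b : ℝ) (L : Vec 6) : ℝ := b * L 0 ^ 2 + b * L 1 ^ 2 + L 2 ^ 2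

end Prolate

/-! Write `U = (ℓ₁₂, ℓ₁₃)`, `W = (ℓ₂₄, ℓ₃₄)` and `U × W = ℓ₁₂ ℓ₃₄ - ℓ₁₃ ℓ₂₄`. The Casimir equations
read `|U|² + |W|² + ℓ₁₄² + ℓ₂₃² = 1` and `U × W + ℓ₁₄ ℓ₂₃ = 0`, and `G_pro = b |U|² + ℓ₁₄²`. The
field of `ℓ₂₃` rotates the planes of `U` and `W` at unit speed and fixes `ℓ₁₄, ℓ₂₃`; this is the
circle action, and it preserves `G_pro`.

Singular points (`singular_cases`). The action is fixed where `U = W = 0`, hence `ℓ₁₄ ℓ₂₃ = 0`,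
which leaves four points. Elsewhere a singular point satisfies `X_G = c X_J`; for `b > 1` a
positivity argument forces `ℓ₁₄ = 0` and exactly one of `U`, `W` to vanish. All singular points thus
lie in three coordinate subspaces of dimension at most three, a null set for four-dimensional
Hausdorff measure.

Types. On the two rank-one families the critical combination induces an operator on `K / L` with
square `-w`, `w > 0`, so its eigenvalues are `±i√w`. At a fixed point the tangent space is `ℂ²` with
coordinates `v₀ + i v₁` and `v₄ + i v₅`, and the linearisation is complex linear. At `ℓ₂₃ = ±1` it
is diagonal with entries `i(s - 2tbℓ₂₃)` and `is`, which is elliptic-elliptic; at `ℓ₁₄ = ±1` it has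
equal diagonal entries `is` and off-diagonal entries `2tℓ₁₄` and `2t(b-1)ℓ₁₄`, hence eigenvalues `is
± 2tℓ₁₄√(b-1)`, which is focus-focus because `b > 1`.

The fibre over `(0, 1)`. The equations become `ℓ₂₃ = 0`, `b|U|² + ℓ₁₄² = 1`, `|W|² = (b-1)|U|²` and
`U ∥ W`. With `ℓ₁₄ = cos θ` and `ζ` the direction of `W`, this gives `U = (sin θ / √b) ζ` and `W =
√(b-1) (|sin θ| / √b) ζ`. The sign of `sin θ` records whether `U` and `W` point the same way, and
`ζ` is lost exactly when `sin θ = 0`, at the two focus-focus points. The induced continuous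
bijection from the compact pinched torus to the Hausdorff fibre is a homeomorphism. -/

namespace PoissonSystem

theorem hasGradientAt_inner {n : ℕ} (a p : Vec n) :
    HasGradientAt (fun q : Vec n => inner ℝ a q) a p := by
  rw [hasGradientAt_iff_hasFDerivAt]
  exact ((InnerProductSpace.toDual ℝ (Vec n)) a).hasFDerivAt

theorem fderiv_apply_coord {n m : ℕ} {f : Vec n → Vec m} {p : Vec n}
    (hf : DifferentiableAt ℝ f p) (v : Vec n) (i : Fin m) :
    fderiv ℝ f p v i = fderiv ℝ (fun q => f q i) p v :=
  (congrArg (fun A => A v)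
    (((EuclideanSpace.proj i : Vec m →L[ℝ] ℝ).hasFDerivAt).comp p hf.hasFDerivAt).fderiv).symm

end PoissonSystem

/-! ### Explicit vector fields, linearisations and tangent spaces; the Jacobi identity. -/

namespace Prolate

open PoissonSystem

theorem toEuclideanLin_structureMatrix (p v : Vec 6) :
    Matrix.toEuclideanLin (structureMatrix p) v =
      !₂[p 3 * v 1 + p 4 * v 2 - p 1 * v 3 - p 2 * v 4,
        -p 3 * v 0 + p 5 * v 2 + p 0 * v 3 - p 2 * v 5,
        -p 4 * v 0 - p 5 * v 1 + p 0 * v 4 + p 1 * v 5,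
        p 1 * v 0 - p 0 * v 1 + p 5 * v 4 - p 4 * v 5,
        p 2 * v 0 - p 0 * v 2 - p 5 * v 3 + p 3 * v 5,
        p 2 * v 1 - p 1 * v 2 + p 4 * v 3 - p 3 * v 4] := by
  ext i
  fin_cases i <;>
    simp [structureMatrix, Matrix.toLpLin_apply, dotProduct, Fin.sum_univ_six] <;>
    ring

theorem hasGradientAt_comb (b s t : ℝ) (p : Vec 6) :
    HasGradientAt (comb ell23 (gPro b) s t)
      !₂[2 * b * t * p 0, 2 * b * t * p 1, 2 * t * p 2, s, 0, 0] p := by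
  rw [hasGradientAt_iff_hasFDerivAt]
  have h : ∀ i : Fin 6, HasFDerivAt (fun q : Vec 6 => q i)
      (EuclideanSpace.proj i : Vec 6 →L[ℝ] ℝ) p :=
    fun i => (EuclideanSpace.proj i : Vec 6 →L[ℝ] ℝ).hasFDerivAt
  have key := ((h 3).const_mul s).add
    (((((h 0).pow 2).const_mul b).add (((h 1).pow 2).const_mul b)).add ((h 2).pow 2) |>.const_mul t)
  refine key.congr_fderiv ?_
  ext v
  simp [PiLp.inner_apply, Fin.sum_univ_six]
  ring

theorem comb_one_zero (b : ℝ) : comb ell23 (gPro b) 1 0 = ell23 := by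
  funext q; simp [comb]

theorem comb_zero_one (b : ℝ) : comb ell23 (gPro b) 0 1 = gPro b := by
  funext q; simp [comb]

theorem hamVF_comb (b s t : ℝ) (p : Vec 6) :
    hamVF structureMatrix (comb ell23 (gPro b) s t) p =
      !₂[2 * t * (b * p 3 * p 1 + p 2 * p 4) - s * p 1,
        2 * t * (-b * p 3 * p 0 + p 2 * p 5) + s * p 0,
        -2 * t * b * (p 0 * p 4 + p 1 * p 5),
        0,
        2 * t * (b - 1) * p 2 * p 0 - s * p 5,
        2 * t * (b - 1) * p 2 * p 1 + s * p 4] := by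
  rw [hamVF, (hasGradientAt_comb b s t p).gradient, toEuclideanLin_structureMatrix]
  ext i
  fin_cases i <;> simp <;> ring

theorem hamVF_ell23 (p : Vec 6) :
    hamVF structureMatrix ell23 p = !₂[-p 1, p 0, 0, 0, -p 5, p 4] := by
  rw [← comb_one_zero 0, hamVF_comb]
  ext i
  fin_cases i <;> simp

theorem hamVF_gPro (b : ℝ) (p : Vec 6) :
    hamVF structureMatrix (gPro b) p =
      !₂[2 * (b * p 3 * p 1 + p 2 * p 4), 2 * (-b * p 3 * p 0 + p 2 * p 5),
        -2 * b * (p 0 * p 4 + p 1 * p 5), 0, 2 * (b - 1) * p 2 * p 0, 2 * (b - 1) * p 2 * p 1] := by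
  rw [← comb_zero_one b, hamVF_comb]
  ext i
  fin_cases i <;> simp

theorem fderiv_ell23_apply (p v : Vec 6) : fderiv ℝ ell23 p v = v 3 := by
  rw [← comb_one_zero 0, (hasGradientAt_comb 0 1 0 p).hasFDerivAt.fderiv]
  simp [PiLp.inner_apply, Fin.sum_univ_six]

theorem fderiv_gPro_apply (b : ℝ) (p v : Vec 6) :
    fderiv ℝ (gPro b) p v = 2 * (b * (p 0 * v 0 + p 1 * v 1) + p 2 * v 2) := by
  rw [← comb_zero_one b, (hasGradientAt_comb b 0 1 p).hasFDerivAt.fderiv]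
  simp [PiLp.inner_apply, Fin.sum_univ_six]
  ring

theorem linearisation_apply (b s t : ℝ) (p v : Vec 6) :
    linearisation structureMatrix ell23 (gPro b) p s t v =
      !₂[2 * t * (b * (p 3 * v 1 + v 3 * p 1) + (p 2 * v 4 + v 2 * p 4)) - s * v 1,
        2 * t * (-b * (p 3 * v 0 + v 3 * p 0) + (p 2 * v 5 + v 2 * p 5)) + s * v 0,
        -2 * t * b * (p 0 * v 4 + v 0 * p 4 + p 1 * v 5 + v 1 * p 5),
        0,
        2 * t * (b - 1) * (p 2 * v 0 + v 2 * p 0) - s * v 5,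
        2 * t * (b - 1) * (p 2 * v 1 + v 2 * p 1) + s * v 4] := by
  have h : ∀ i : Fin 6, HasFDerivAt (fun q : Vec 6 => q i)
      (EuclideanSpace.proj i : Vec 6 →L[ℝ] ℝ) p :=
    fun i => (EuclideanSpace.proj i : Vec 6 →L[ℝ] ℝ).hasFDerivAt
  have hd : DifferentiableAt ℝ (hamVF structureMatrix (comb ell23 (gPro b) s t)) p := by
    rw [differentiableAt_euclidean]
    simp only [hamVF_comb]
    intro i
    have := fun i => (h i).differentiableAt
    fin_cases i <;> simp <;> fun_prop
  rw [linearisation]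
  have key0 := (((((h 3).const_mul b).mul (h 1)).add ((h 2).mul (h 4))).const_mul (2 * t)).sub
    ((h 1).const_mul s)
  have key1 := (((((h 3).const_mul (-b)).mul (h 0)).add ((h 2).mul (h 5))).const_mul (2 * t)).add
    ((h 0).const_mul s)
  have key2 := (((h 0).mul (h 4)).add ((h 1).mul (h 5))).const_mul (-2 * t * b)
  have key4 := (((h 2).const_mul (2 * t * (b - 1))).mul (h 0)).sub ((h 5).const_mul s)
  have key5 := (((h 2).const_mul (2 * t * (b - 1))).mul (h 1)).add ((h 4).const_mul s)
  ext i
  rw [fderiv_apply_coord hd]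
  simp only [hamVF_comb]
  fin_cases i
  · refine (congrArg (fun A => A v) key0.fderiv).trans ?_
    simp
    ring
  · refine (congrArg (fun A => A v) key1.fderiv).trans ?_
    simp
    ring
  · refine (congrArg (fun A => A v) key2.fderiv).trans ?_
    simp
    ring
  · simp
  · refine (congrArg (fun A => A v) key4.fderiv).trans ?_
    simp
    ring
  · refine (congrArg (fun A => A v) key5.fderiv).trans ?_
    simp
    ring

/-- The two equations are the vanishing of the Casimir differentials. They hold on the range of `B`
for any `p`; conversely, at the Casimir values `1` and `0` the square of `B` is `-1` on their
solution space. -/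
theorem mem_charSpace_iff {p : Vec 6} (hp : p ∈ phaseSpace) (v : Vec 6) :
    v ∈ charSpace structureMatrix p ↔
      p 0 * v 0 + p 1 * v 1 + p 2 * v 2 + p 3 * v 3 + p 4 * v 4 + p 5 * v 5 = 0 ∧
        p 5 * v 0 - p 4 * v 1 + p 3 * v 2 + p 2 * v 3 - p 1 * v 4 + p 0 * v 5 = 0 := by
  obtain ⟨h1, h2⟩ := (mem_phaseSpace_iff p).1 hp
  rw [charSpace, LinearMap.mem_range]
  constructor
  · rintro ⟨η, rfl⟩
    rw [toEuclideanLin_structureMatrix]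
    constructor <;> simp <;> ring
  · rintro ⟨h3, h4⟩
    -- Since `B² v = -v`, a preimage of `v` is `-B v`.
    refine ⟨-Matrix.toEuclideanLin (structureMatrix p) v, ?_⟩
    simp only [toEuclideanLin_structureMatrix]
    ext i
    fin_cases i <;> simp
    · linear_combination v 0 * h1 - p 0 * h3 - p 5 * h4 + 2 * v 5 * h2
    · linear_combination v 1 * h1 - p 1 * h3 + p 4 * h4 - 2 * v 4 * h2
    · linear_combination v 2 * h1 - p 2 * h3 - p 3 * h4 + 2 * v 3 * h2
    · linear_combination v 3 * h1 - p 3 * h3 - p 2 * h4 + 2 * v 2 * h2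
    · linear_combination v 4 * h1 - p 4 * h3 + p 1 * h4 - 2 * v 1 * h2
    · linear_combination v 5 * h1 - p 5 * h3 - p 0 * h4 + 2 * v 0 * h2

theorem mem_commonKernel_iff {p : Vec 6} (hp : p ∈ phaseSpace) (b : ℝ) (v : Vec 6) :
    v ∈ commonKernel structureMatrix ell23 (gPro b) p ↔
      (p 0 * v 0 + p 1 * v 1 + p 2 * v 2 + p 3 * v 3 + p 4 * v 4 + p 5 * v 5 = 0 ∧
        p 5 * v 0 - p 4 * v 1 + p 3 * v 2 + p 2 * v 3 - p 1 * v 4 + p 0 * v 5 = 0) ∧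
      v 3 = 0 ∧ b * (p 0 * v 0 + p 1 * v 1) + p 2 * v 2 = 0 := by
  rw [commonKernel, Submodule.mem_inf, Submodule.mem_inf, mem_charSpace_iff hp, LinearMap.mem_ker,
    LinearMap.mem_ker, ContinuousLinearMap.coe_coe, ContinuousLinearMap.coe_coe,
    fderiv_ell23_apply, fderiv_gPro_apply, and_assoc]
  simp

/-- The structure constants of `so(4)`: `structureMatrix` has the entries `∑ m, Lₘ cₘⱼₖ`. -/
def structureConstant (m j k : Fin 6) : ℤ :=
  (!![    0,  L 3,  L 4, -L 1, -L 2,    0;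
      -L 3,    0,  L 5,  L 0,    0, -L 2;
      -L 4, -L 5,    0,    0,  L 0,  L 1;
       L 1, -L 0,    0,    0,  L 5, -L 4;
       L 2,    0, -L 0, -L 5,    0,  L 3;
         0,  L 2, -L 1,  L 4, -L 3,    0] : Matrix (Fin 6) (Fin 6) ℤ) j k
where
  L (i : Fin 6) : ℤ := if i = m then 1 else 0

/-- For a linear bracket the Jacobi identity is a finite family of identities between structure
constants; with integer constants it is checked by evaluation. -/
theorem structureConstant_jacobi : ∀ m i j k : Fin 6,
    ∑ l, (structureConstant m i l * structureConstant l j k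
      + structureConstant m j l * structureConstant l k i
      + structureConstant m k l * structureConstant l i j) = 0 := by
  decide +kernel

theorem structureMatrix_apply (p : Vec 6) (j k : Fin 6) :
    structureMatrix p j k = ∑ m, (structureConstant m j k : ℝ) * p m := by
  fin_cases j <;> fin_cases k <;>
    simp [structureMatrix, structureConstant, structureConstant.L]

theorem gradient_structureMatrix (j k : Fin 6) (p : Vec 6) :
    gradient (fun q => structureMatrix q j k) p =
      WithLp.toLp 2 (fun l => (structureConstant l j k : ℝ)) := by
  refine HasGradientAt.gradient ?_
  convert hasGradientAt_inner _ p using 2 with q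
  simp [PiLp.inner_apply, structureMatrix_apply, mul_comm]

theorem bracket_coord (i j k : Fin 6) (p : Vec 6) :
    bracket structureMatrix (fun q => q i) (fun q => structureMatrix q j k) p =
      ∑ m, (∑ l, (structureConstant m i l * structureConstant l j k : ℝ)) * p m := by
  have h : gradient (fun q : Vec 6 => q i) p = EuclideanSpace.single i 1 := by
    refine HasGradientAt.gradient ?_
    convert hasGradientAt_inner _ p using 2 with q
    simp [EuclideanSpace.inner_single_left]
  rw [bracket, hamVF, h, gradient_structureMatrix, EuclideanSpace.inner_single_left]
  simp only [Matrix.toLpLin_apply, Matrix.mulVec, dotProduct, structureMatrix_apply, map_one,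
    one_mul, Finset.sum_mul]
  rw [Finset.sum_comm]
  exact Finset.sum_congr rfl fun _ _ => Finset.sum_congr rfl fun _ _ => by ring

theorem isPoisson_structureMatrix : IsPoisson structureMatrix where
  smooth i j := by
    have : ∀ i : Fin 6, ContDiff ℝ ∞ (fun q : Vec 6 => q i) :=
      fun i => (EuclideanSpace.proj i : Vec 6 →L[ℝ] ℝ).contDiff
    simp only [structureMatrix_apply]
    fun_prop
  antisymm p i j := by
    fin_cases i <;> fin_cases j <;> simp [structureMatrix]
  jacobi p i j k := by
    simp only [bracket_coord, ← Finset.sum_add_distrib, ← add_mul]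
    refine Finset.sum_eq_zero fun m _ => ?_
    have h := congrArg (Int.cast : ℤ → ℝ) (structureConstant_jacobi m i j k)
    push_cast at h
    rw [h, zero_mul]

end Prolate

/-! ### Eigenvalues of the transverse operator. -/

namespace PoissonSystem

section Eigenvalues

variable {n : ℕ} {B : MatField n} {J H : Vec n → ℝ} {p : Vec n}

/-- If the induced operator on `K / L` squares to `-ν²`, its eigenvalues are `±iν`. -/
theorem isTransverseEigenvalue_iff_of_sq {s t ν : ℝ} (hν : ν ≠ 0)
    (hK : ∀ v ∈ commonKernel B J H p, linearisation B J H p s t v ∈ commonKernel B J H p)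
    (hL : ∀ v ∈ orbitSpace B J H p, linearisation B J H p s t v ∈ orbitSpace B J H p)
    (hsq : ∀ v ∈ commonKernel B J H p,
      linearisation B J H p s t (linearisation B J H p s t v) + ν ^ 2 • v ∈ orbitSpace B J H p)
    (hne : ∃ v ∈ commonKernel B J H p, v ∉ orbitSpace B J H p) (z : ℂ) :
    IsTransverseEigenvalue B J H p s t z ↔ z.re = 0 ∧ (z.im = ν ∨ z.im = -ν) := by
  set A := linearisation B J H p s t
  set L := orbitSpace B J H p
  constructor
  · rintro ⟨u, hu, v, hv, hn, h1, h2⟩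
    set x := z.re
    set y := z.im
    -- `e1` and `e2` are the real and imaginary parts of `(z² + ν²)(u + iv) = 0` modulo `L`;
    -- multiplying by the conjugate of `z² + ν²` then gives `|z² + ν²|² u, |z² + ν²|² v ∈ L`, so `z²
    -- = -ν²`.
    have e1 : (x ^ 2 - y ^ 2 + ν ^ 2) • u - (2 * x * y) • v ∈ L := by
      have := L.sub_mem (L.sub_mem (hsq u hu) (hL _ h1))
        (L.sub_mem (L.smul_mem x h1) (L.smul_mem y h2))
      convert this using 1
      simp only [map_sub, map_smul]
      module
    have e2 : (2 * x * y) • u + (x ^ 2 - y ^ 2 + ν ^ 2) • v ∈ L := by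
      have := L.sub_mem (L.sub_mem (hsq v hv) (hL _ h2))
        (L.add_mem (L.smul_mem y h1) (L.smul_mem x h2))
      convert this using 1
      simp only [map_sub, map_add, map_smul]
      module
    have f1 : ((x ^ 2 - y ^ 2 + ν ^ 2) ^ 2 + (2 * x * y) ^ 2) • u ∈ L := by
      have := L.add_mem (L.smul_mem (x ^ 2 - y ^ 2 + ν ^ 2) e1) (L.smul_mem (2 * x * y) e2)
      convert this using 1
      module
    have f2 : ((x ^ 2 - y ^ 2 + ν ^ 2) ^ 2 + (2 * x * y) ^ 2) • v ∈ L := by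
      have := L.sub_mem (L.smul_mem (x ^ 2 - y ^ 2 + ν ^ 2) e2) (L.smul_mem (2 * x * y) e1)
      convert this using 1
      module
    have g : (x ^ 2 - y ^ 2 + ν ^ 2) ^ 2 + (2 * x * y) ^ 2 = 0 := by
      by_contra h
      exact hn ⟨(L.smul_mem_iff h).1 f1, (L.smul_mem_iff h).1 f2⟩
    have g1 : x ^ 2 - y ^ 2 + ν ^ 2 = 0 := by
      nlinarith [sq_nonneg (x ^ 2 - y ^ 2 + ν ^ 2), sq_nonneg (2 * x * y)]
    have g2 : x * y = 0 := by
      nlinarith [sq_nonneg (x ^ 2 - y ^ 2 + ν ^ 2), sq_nonneg (x * y)]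
    have hν2 : 0 < ν ^ 2 := by positivity
    rcases mul_eq_zero.1 g2 with h | h
    · refine ⟨h, sq_eq_sq_iff_eq_or_eq_neg.1 ?_⟩
      rw [h] at g1
      linarith
    · rw [h] at g1
      nlinarith [sq_nonneg x]
  · obtain ⟨v, hv, hvL⟩ := hne
    intro h
    have hz2 : z.im ^ 2 = ν ^ 2 := sq_eq_sq_iff_eq_or_eq_neg.2 h.2
    have hz0 : z.im ≠ 0 := by
      intro h0
      rw [h0] at hz2
      exact hν (by simpa using hz2.symm)
    -- For `z = iy` with `y² = ν²`, the vector `A v + i y v` is an eigenvector modulo `L`, because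
    -- `A² v = -y² v` there.
    refine ⟨A v, hK v hv, z.im • v, Submodule.smul_mem _ _ hv,
      fun hh => hvL ((L.smul_mem_iff hz0).1 hh.2), ?_, ?_⟩
    · have := hsq v hv
      rw [← hz2] at this
      convert this using 1
      rw [h.1]
      module
    · convert L.zero_mem using 1
      rw [h.1, map_smul]
      module

theorem isRegularComb_of_sq {s t ν : ℝ} (hν : ν ≠ 0) (hr : rank B J H p = 1)
    (h0 : hamVF B (comb J H s t) p = 0)
    (hz : ∀ z : ℂ, IsTransverseEigenvalue B J H p s t z ↔ z.re = 0 ∧ (z.im = ν ∨ z.im = -ν)) :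
    IsRegularComb B J H p s t := by
  refine ⟨h0, ?_⟩
  have : {z : ℂ | IsTransverseEigenvalue B J H p s t z} = {⟨0, ν⟩, ⟨0, -ν⟩} := by
    ext z
    simp only [Set.mem_ofPred_eq, hz, Set.mem_insert_iff, Set.mem_singleton_iff, Complex.ext_iff]
    tauto
  rw [this, hr, Set.encard_pair]
  · norm_num
  · intro h
    have := (Complex.ext_iff.1 h).2
    simp only at this
    exact hν (by linarith)

/-- In the complex coordinate `F` on `K`, the operator `A` is multiplication by `μ`. -/
def ActsBy (K : Submodule ℝ (Vec n)) (A : Vec n →L[ℝ] Vec n) (F : Vec n →ₗ[ℝ] ℂ) (μ : ℂ) : Prop :=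
  ∀ v ∈ K, F (A v) = μ * F v

/-- The complex-linear extension of `F` takes the values `F u ± i F v` on `u ± iv`, which are
eigenvectors for `z` and its conjugate. If neither `z` nor its conjugate equals `μ`, both values
vanish, and so do `F u` and `F v`. -/
theorem ActsBy.eq_or_eq_conj {K : Submodule ℝ (Vec n)} {A : Vec n →L[ℝ] Vec n}
    {F : Vec n →ₗ[ℝ] ℂ} {μ z : ℂ} (h : ActsBy K A F μ) {u v : Vec n} (hu : u ∈ K) (hv : v ∈ K)
    (h1 : A u = z.re • u - z.im • v) (h2 : A v = z.im • u + z.re • v)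
    (hne : ¬ (F u = 0 ∧ F v = 0)) :
    z = μ ∨ z = starRingEnd ℂ μ := by
  have a1 := h u hu
  have a2 := h v hv
  rw [h1] at a1
  rw [h2] at a2
  simp only [map_sub, map_add, map_smul, Complex.real_smul] at a1 a2
  have hz := Complex.re_add_im z
  have hz' : starRingEnd ℂ z = z.re - z.im * Complex.I := by
    apply Complex.ext <;> simp
  have b1 : (z - μ) * (F u + Complex.I * F v) = 0 := by
    linear_combination a1 + Complex.I * a2 - (F u + Complex.I * F v) * hz
      + z.im * F v * Complex.I_sq
  have b2 : (starRingEnd ℂ z - μ) * (F u - Complex.I * F v) = 0 := by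
    linear_combination a1 - Complex.I * a2 + (F u - Complex.I * F v) * hz'
      + z.im * F v * Complex.I_sq
  rcases mul_eq_zero.1 b1 with h | h
  · exact Or.inl (sub_eq_zero.1 h)
  rcases mul_eq_zero.1 b2 with h' | h'
  · right
    rw [← sub_eq_zero.1 h', Complex.conj_conj]
  · refine absurd ⟨?_, ?_⟩ hne
    · linear_combination (h + h') / 2
    · linear_combination (h - h') * (-Complex.I / 2) + F v * Complex.I_sq

/-- At a point of rank zero where the linearisation is diagonal in two complex coordinates on the
tangent space, the eigenvalues are the diagonal entries and their conjugates. -/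
theorem isTransverseEigenvalue_iff_of_actsBy {s t : ℝ} {F G : Vec n →ₗ[ℝ] ℂ} {μ κ : ℂ}
    (hL : orbitSpace B J H p = ⊥)
    (hK : ∀ v ∈ commonKernel B J H p, linearisation B J H p s t v ∈ commonKernel B J H p)
    (hF : ActsBy (commonKernel B J H p) (linearisation B J H p s t) F μ)
    (hG : ActsBy (commonKernel B J H p) (linearisation B J H p s t) G κ)
    (hinj : ∀ v ∈ commonKernel B J H p, F v = 0 → G v = 0 → v = 0)
    (hsF : ∀ c, ∃ v ∈ commonKernel B J H p, F v = c ∧ G v = 0)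
    (hsG : ∀ c, ∃ v ∈ commonKernel B J H p, F v = 0 ∧ G v = c) (z : ℂ) :
    IsTransverseEigenvalue B J H p s t z ↔
      z = μ ∨ z = starRingEnd ℂ μ ∨ z = κ ∨ z = starRingEnd ℂ κ := by
  set A := linearisation B J H p s t
  set K := commonKernel B J H p
  have exist : ∀ (F' G' : Vec n →ₗ[ℝ] ℂ) (m m' : ℂ), ActsBy K A F' m → ActsBy K A G' m' →
      (∀ v ∈ K, F' v = 0 → G' v = 0 → v = 0) → (∀ c, ∃ v ∈ K, F' v = c ∧ G' v = 0) →
      (z = m ∨ z = starRingEnd ℂ m) → IsTransverseEigenvalue B J H p s t z := by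
    intro F' G' m m' hF' hG' hi hs h
    -- The sign `σ` treats `z = m` and `z = conj m` together. With `F' u = 1`, `F' v = -σi` and `G'`
    -- zero on both, the equation `A u = Re z · u - Im z · v` becomes `m = Re z + σ i Im z`.
    have main : ∀ σ : ℝ, σ ^ 2 = 1 → (m = z.re + σ * z.im * Complex.I) →
        IsTransverseEigenvalue B J H p s t z := by
      intro σ hσ hm
      have hσ' : (σ : ℂ) ^ 2 = 1 := by exact_mod_cast hσ
      obtain ⟨u, hu, hu1, hu2⟩ := hs 1
      obtain ⟨v, hv, hv1, hv2⟩ := hs (-σ * Complex.I)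
      refine ⟨u, hu, v, hv, ?_, ?_, ?_⟩
      · rw [hL, Submodule.mem_bot, Submodule.mem_bot]
        rintro ⟨rfl, -⟩
        simp at hu1
      · rw [hL, Submodule.mem_bot]
        refine hi _ (K.sub_mem (hK u hu) (K.sub_mem (K.smul_mem _ hu) (K.smul_mem _ hv))) ?_ ?_
        · simp only [map_sub, map_smul, Complex.real_smul]
          rw [hF' u hu, hu1, hv1, hm]
          ring
        · simp only [map_sub, map_smul, Complex.real_smul]
          rw [hG' u hu, hu2, hv2]
          ring
      · rw [hL, Submodule.mem_bot]
        refine hi _ (K.sub_mem (hK v hv) (K.add_mem (K.smul_mem _ hu) (K.smul_mem _ hv))) ?_ ?_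
        · simp only [map_sub, map_add, map_smul, Complex.real_smul]
          rw [hF' v hv, hu1, hv1, hm]
          linear_combination -z.im * hσ' * Complex.I ^ 2 - z.im * Complex.I_sq
        · simp only [map_sub, map_add, map_smul, Complex.real_smul]
          rw [hG' v hv, hu2, hv2]
          ring
    rcases h with h | h
    · refine main 1 (by norm_num) ?_
      rw [← h]
      simp
    · refine main (-1) (by norm_num) ?_
      rw [← Complex.conj_conj m, ← h]
      apply Complex.ext <;> simp
  constructor
  · rintro ⟨u, hu, v, hv, hn, h1, h2⟩
    rw [hL, Submodule.mem_bot, sub_eq_zero] at h1 h2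
    by_cases hne : F u = 0 ∧ F v = 0
    · have := hG.eq_or_eq_conj hu hv h1 h2 fun h => hn <| by
        rw [hinj u hu hne.1 h.1, hinj v hv hne.2 h.2]
        exact ⟨Submodule.zero_mem _, Submodule.zero_mem _⟩
      tauto
    · have := hF.eq_or_eq_conj hu hv h1 h2 hne
      tauto
  · intro h
    have h : (z = μ ∨ z = starRingEnd ℂ μ) ∨ (z = κ ∨ z = starRingEnd ℂ κ) := by tauto
    rcases h with h | h
    · exact exist F G μ κ hF hG hinj hsF h
    · refine exist G F κ μ hG hF (fun v hv h1 h2 => hinj v hv h2 h1) (fun c => ?_) h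
      obtain ⟨v, hv, h1, h2⟩ := hsG c
      exact ⟨v, hv, h2, h1⟩

theorem isRegularComb_of_actsBy {s t : ℝ} {μ κ : ℂ} (hr : rank B J H p = 0)
    (h0 : hamVF B (comb J H s t) p = 0)
    (hz : ∀ z : ℂ, IsTransverseEigenvalue B J H p s t z ↔
      z = μ ∨ z = starRingEnd ℂ μ ∨ z = κ ∨ z = starRingEnd ℂ κ)
    (hμ : μ.im ≠ 0) (hκ : κ.im ≠ 0) (h1 : μ ≠ κ) (h2 : μ ≠ starRingEnd ℂ κ) :
    IsRegularComb B J H p s t := by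
  have ne_conj : ∀ z : ℂ, z.im ≠ 0 → z ≠ starRingEnd ℂ z := fun z h h' =>
    h (Complex.conj_eq_iff_im.1 h'.symm)
  have h3 : starRingEnd ℂ μ ≠ κ := fun h => h2 (by rw [← h, Complex.conj_conj])
  have h4 : starRingEnd ℂ μ ≠ starRingEnd ℂ κ := fun h => h1 ((starRingEnd ℂ).injective h)
  refine ⟨h0, ?_⟩
  have : {z : ℂ | IsTransverseEigenvalue B J H p s t z} =
      {μ, starRingEnd ℂ μ, κ, starRingEnd ℂ κ} := by
    ext z
    simp only [Set.mem_ofPred_eq, hz, Set.mem_insert_iff, Set.mem_singleton_iff]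
  rw [this, hr, Set.encard_insert_of_notMem, Set.encard_insert_of_notMem, Set.encard_pair]
  · norm_num
  · exact ne_conj κ hκ
  · simp [h3, h4]
  · simp [h1, h2, ne_conj μ hμ]

end Eigenvalues

end PoissonSystem

/-! ### The rank of the momentum map. -/

namespace PoissonSystem

variable {n : ℕ} {B : MatField n} {J H : Vec n → ℝ} {p : Vec n}

theorem IsSingular.exists_eq_smul (h : IsSingular B J H p) (hJ : hamVF B J p ≠ 0) :
    ∃ c : ℝ, hamVF B H p = c • hamVF B J p := by
  by_contra! hc
  have hli : LinearIndependent ℝ ![hamVF B J p, hamVF B H p] :=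
    (LinearIndependent.pair_iff' hJ).2 fun a => (hc a).symm
  have := finrank_span_eq_card hli
  rw [Matrix.range_cons_cons_empty] at this
  rw [IsSingular, rank, orbitSpace, this] at h
  simp at h

theorem orbitSpace_eq_span {c : ℝ} (h : hamVF B H p = c • hamVF B J p) :
    orbitSpace B J H p = Submodule.span ℝ {hamVF B J p} := by
  rw [orbitSpace, h, Set.pair_comm]
  exact Submodule.span_insert_eq_span
    (Submodule.smul_mem _ _ (Submodule.mem_span_singleton_self _))

theorem rank_eq_one {c : ℝ} (hJ : hamVF B J p ≠ 0) (h : hamVF B H p = c • hamVF B J p) :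
    rank B J H p = 1 := by
  rw [rank, orbitSpace_eq_span h, finrank_span_singleton hJ]

theorem hamVF_eq_zero_of_rank_eq_zero (h : rank B J H p = 0) : hamVF B J p = 0 := by
  rw [rank, Submodule.finrank_eq_zero] at h
  have : hamVF B J p ∈ orbitSpace B J H p := Submodule.subset_span (by simp)
  rwa [h, Submodule.mem_bot] at this

theorem orbitSpace_eq_bot (hJ : hamVF B J p = 0) (hH : hamVF B H p = 0) :
    orbitSpace B J H p = ⊥ := by
  simp [orbitSpace, hJ, hH]

theorem rank_eq_zero (hJ : hamVF B J p = 0) (hH : hamVF B H p = 0) : rank B J H p = 0 := by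
  rw [rank, orbitSpace_eq_bot hJ hH, finrank_bot]

end PoissonSystem

/-! ### Classification of the singular points. -/

namespace Prolate

open PoissonSystem

variable {b : ℝ} {p : Vec 6}

theorem sq_add_sq_pos {x y : ℝ} (h : ¬ (x = 0 ∧ y = 0)) : 0 < x ^ 2 + y ^ 2 := by
  by_contra hn
  exact h ⟨by nlinarith [sq_nonneg x, sq_nonneg y], by nlinarith [sq_nonneg x, sq_nonneg y]⟩

theorem hamVF_ell23_eq_zero_iff :
    hamVF structureMatrix ell23 p = 0 ↔ (p 0 = 0 ∧ p 1 = 0) ∧ p 4 = 0 ∧ p 5 = 0 := by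
  rw [hamVF_ell23]
  constructor
  · intro h
    have h := fun i => congrArg (fun v : Vec 6 => v i) h
    exact ⟨⟨by simpa using h 1, by simpa using h 0⟩, by simpa using h 5, by simpa using h 4⟩
  · rintro ⟨⟨h0, h1⟩, h4, h5⟩
    ext i
    fin_cases i <;> simp [*]

/-- Singular points are the zeros of `X_{ℓ₂₃}` and the points of two coordinate subspaces. -/
theorem singular_cases (hb : 1 < b) (hp : p ∈ phaseSpace)
    (h : IsSingular structureMatrix ell23 (gPro b) p) :
    ((p 0 = 0 ∧ p 1 = 0) ∧ p 4 = 0 ∧ p 5 = 0) ∨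
      (((p 0 = 0 ∧ p 1 = 0) ∧ p 2 = 0) ∧ ¬ (p 4 = 0 ∧ p 5 = 0)) ∨
      ((p 2 = 0 ∧ p 4 = 0 ∧ p 5 = 0) ∧ ¬ (p 0 = 0 ∧ p 1 = 0)) := by
  obtain ⟨-, hq⟩ := (mem_phaseSpace_iff p).1 hp
  by_cases hJ : hamVF structureMatrix ell23 p = 0
  · exact Or.inl (hamVF_ell23_eq_zero_iff.1 hJ)
  obtain ⟨c, hc⟩ := h.exists_eq_smul hJ
  rw [hamVF_gPro, hamVF_ell23] at hc
  have hc := fun i => congrArg (fun v : Vec 6 => v i) hc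
  have e0 := hc 0
  have e1 := hc 1
  have e2 := hc 2
  have e4 := hc 4
  have e5 := hc 5
  simp at e0 e1 e2 e4 e5
  rw [hamVF_ell23_eq_zero_iff] at hJ
  -- The `ℓ₁₄`-component of `X_G = c X_J` gives `U · W = 0`.
  have hUW : p 0 * p 4 + p 1 * p 5 = 0 := by
    rcases e2 with h | h
    · linarith
    · exact h
  by_cases h2 : p 2 = 0
  -- Lagrange's identity `|U|² |W|² = (U · W)² + (U × W)²`, where `U × W = -ℓ₁₄ ℓ₂₃ = 0`.
  · have hz : (p 0 ^ 2 + p 1 ^ 2) * (p 4 ^ 2 + p 5 ^ 2) = 0 := by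
      rw [h2] at hq
      linear_combination (p 0 * p 4 + p 1 * p 5) * hUW + (p 0 * p 5 - p 1 * p 4) * hq
    by_cases hU : p 0 = 0 ∧ p 1 = 0
    · exact Or.inr (Or.inl ⟨⟨hU, h2⟩, fun hW => hJ ⟨hU, hW⟩⟩)
    · refine Or.inr (Or.inr ⟨⟨h2, ?_⟩, hU⟩)
      by_contra hW
      exact (mul_pos (sq_add_sq_pos hU) (sq_add_sq_pos hW)).ne' hz
  · exfalso
    -- `f1` pairs the `W`-components of `X_G = c X_J` with `U`, and `f2` takes the cross product of
    -- its `U`-components with `U`. Eliminating `c` gives `f3`, a vanishing sum of nonnegative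
    -- terms, which forces `U = 0` and then `W = 0`.
    have f1 : 2 * (b - 1) * (p 0 ^ 2 + p 1 ^ 2) = c * p 3 := by
      apply mul_left_cancel₀ h2
      linear_combination p 0 * e4 + p 1 * e5 - c * hq
    have f2 : c * (p 0 ^ 2 + p 1 ^ 2) =
        -2 * b * p 3 * (p 0 ^ 2 + p 1 ^ 2) - 2 * p 2 ^ 2 * p 3 := by
      linear_combination p 1 * e0 - p 0 * e1 + 2 * p 2 * hq
    have f3 : 2 * (b - 1) * (p 0 ^ 2 + p 1 ^ 2) ^ 2 +
        2 * p 3 ^ 2 * (b * (p 0 ^ 2 + p 1 ^ 2) + p 2 ^ 2) = 0 := by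
      linear_combination (p 0 ^ 2 + p 1 ^ 2) * f1 + p 3 * f2
    have hU : p 0 = 0 ∧ p 1 = 0 := by
      by_contra hU
      have hU := sq_add_sq_pos hU
      have : 0 < 2 * (b - 1) * (p 0 ^ 2 + p 1 ^ 2) ^ 2 :=
        mul_pos (by linarith) (pow_pos hU 2)
      have : 0 ≤ 2 * p 3 ^ 2 * (b * (p 0 ^ 2 + p 1 ^ 2) + p 2 ^ 2) := by
        have : 0 ≤ b := by linarith
        positivity
      linarith
    refine hJ ⟨hU, ?_, ?_⟩
    · simpa [h2, hU.1, hU.2] using e0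
    · simpa [h2, hU.1, hU.2] using e1

/-- Common conclusion for both rank-one families: an operator on `K / L` with square `-w` has the
two distinct eigenvalues `±i√w`, which gives regularity and ellipticity at once. -/
theorem isElliptic_of_sq {s t w : ℝ} (hw : 0 < w) {c : ℝ}
    (hJ : hamVF structureMatrix ell23 p ≠ 0)
    (hc : hamVF structureMatrix (gPro b) p = c • hamVF structureMatrix ell23 p)
    (h0 : hamVF structureMatrix (comb ell23 (gPro b) s t) p = 0)
    (hK : ∀ v ∈ commonKernel structureMatrix ell23 (gPro b) p,
      linearisation structureMatrix ell23 (gPro b) p s t v ∈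
        commonKernel structureMatrix ell23 (gPro b) p)
    (hL : ∀ v ∈ orbitSpace structureMatrix ell23 (gPro b) p,
      linearisation structureMatrix ell23 (gPro b) p s t v ∈
        orbitSpace structureMatrix ell23 (gPro b) p)
    (hsq : ∀ v ∈ commonKernel structureMatrix ell23 (gPro b) p,
      linearisation structureMatrix ell23 (gPro b) p s t
        (linearisation structureMatrix ell23 (gPro b) p s t v) + w • v ∈
        orbitSpace structureMatrix ell23 (gPro b) p)
    (hne : ∃ v ∈ commonKernel structureMatrix ell23 (gPro b) p,
      v ∉ orbitSpace structureMatrix ell23 (gPro b) p)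
    (hnd : ∀ s t : ℝ, hamVF structureMatrix (comb ell23 (gPro b) s t) p = 0 →
      (∀ u ∈ commonKernel structureMatrix ell23 (gPro b) p,
        linearisation structureMatrix ell23 (gPro b) p s t u ∈
          orbitSpace structureMatrix ell23 (gPro b) p) → s = 0 ∧ t = 0) :
    IsEllipticPoint structureMatrix ell23 (gPro b) p := by
  have hr := rank_eq_one hJ hc
  have hw' : √w ≠ 0 := (Real.sqrt_pos.2 hw).ne'
  have hz := isTransverseEigenvalue_iff_of_sq hw' hK hL
    (fun v hv => by rw [Real.sq_sqrt hw.le]; exact hsq v hv) hne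
  have hreg := isRegularComb_of_sq hw' hr h0 hz
  exact ⟨by rw [IsSingular, hr]; norm_num, ⟨hnd, s, t, hreg⟩, s, t, hreg, fun z h => ((hz z).1 h).1⟩

/-- Here `G_pro` itself is critical. The transverse vector `v = (W, 0, 0, 0, 0)` detects
non-degeneracy: its image has `ℓ₁₄`-component `-2tb|W|²`, while vectors of `L` have none. -/
theorem isEllipticPoint_of_u_eq_zero (hb : 1 < b) (hp : p ∈ phaseSpace)
    (h : ((p 0 = 0 ∧ p 1 = 0) ∧ p 2 = 0) ∧ ¬ (p 4 = 0 ∧ p 5 = 0)) :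
    IsEllipticPoint structureMatrix ell23 (gPro b) p := by
  obtain ⟨⟨⟨h0, h1⟩, h2⟩, hW⟩ := h
  have hWpos := sq_add_sq_pos hW
  have hJ : hamVF structureMatrix ell23 p ≠ 0 := fun h => hW (hamVF_ell23_eq_zero_iff.1 h).2
  have hc : hamVF structureMatrix (gPro b) p = (0 : ℝ) • hamVF structureMatrix ell23 p := by
    rw [hamVF_gPro]
    ext i
    fin_cases i <;> simp [h0, h1, h2]
  have hLmem : ∀ v, v ∈ orbitSpace structureMatrix ell23 (gPro b) p ↔
      ∃ a : ℝ, a • hamVF structureMatrix ell23 p = v := by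
    intro v
    rw [orbitSpace_eq_span hc, Submodule.mem_span_singleton]
  have hv0 : !₂[p 4, p 5, 0, 0, 0, 0] ∈ commonKernel structureMatrix ell23 (gPro b) p := by
    rw [mem_commonKernel_iff hp]
    simp [h0, h1, h2]
    ring
  refine isElliptic_of_sq (s := 0) (t := 1) (w := 4 * b * (b * p 3 ^ 2 + (p 4 ^ 2 + p 5 ^ 2)))
    (by have : 0 ≤ b * p 3 ^ 2 := mul_nonneg (by linarith) (sq_nonneg _)
        exact mul_pos (by linarith) (by linarith)) hJ hc ?_ ?_ ?_ ?_ ?_ ?_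
  · rw [hamVF_comb]
    ext i
    fin_cases i <;> simp [h0, h1, h2]
  · intro v hv
    rw [mem_commonKernel_iff hp] at hv ⊢
    obtain ⟨⟨-, hv2⟩, hv3, -⟩ := hv
    rw [linearisation_apply]
    simp [h0, h1, h2, hv3] at hv2 ⊢
    ring
  · intro v hv
    obtain ⟨a, rfl⟩ := (hLmem v).1 hv
    convert Submodule.zero_mem _
    rw [hamVF_ell23, linearisation_apply]
    ext i
    fin_cases i <;> simp [h0, h1, h2]
  · intro v hv
    rw [mem_commonKernel_iff hp] at hv
    obtain ⟨⟨hv1, hv2⟩, hv3, -⟩ := hv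
    simp [h0, h1, h2, hv3] at hv1 hv2
    rw [hLmem]
    -- The part `(v₄, v₅)` is orthogonal to `W`, so it is a multiple of the rotated vector `(-p₅,
    -- p₄)`. It is absent from `A² v`, so `A² v + w v` is `w` times that multiple of `X_J`.
    refine ⟨4 * b * (b * p 3 ^ 2 + (p 4 ^ 2 + p 5 ^ 2)) * ((p 4 * v 5 - p 5 * v 4) /
      (p 4 ^ 2 + p 5 ^ 2)), ?_⟩
    rw [hamVF_ell23]
    simp only [linearisation_apply]
    ext i
    fin_cases i <;> simp [h0, h1, h2, hv3]
    · linear_combination -4 * b * p 5 * hv2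
    · linear_combination 4 * b * p 4 * hv2
    · linear_combination -4 * b * b * p 3 * hv2
    · field_simp
      linear_combination -p 4 * hv1
    · field_simp
      linear_combination -p 5 * hv1
  · refine ⟨_, hv0, fun hm => hW ?_⟩
    obtain ⟨a, ha⟩ := (hLmem _).1 hm
    rw [hamVF_ell23] at ha
    have ha := fun i => congrArg (fun v : Vec 6 => v i) ha
    have a0 := ha 0
    have a1 := ha 1
    simp [h0, h1] at a0 a1
    exact ⟨a0.symm, a1.symm⟩
  · intro s t hst hz
    rw [hamVF_comb] at hst
    have hst := fun i => congrArg (fun v : Vec 6 => v i) hst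
    have s4 := hst 4
    have s5 := hst 5
    simp [h0, h1, h2] at s4 s5
    have hs : s = 0 := by tauto
    refine ⟨hs, ?_⟩
    obtain ⟨a, ha⟩ := (hLmem _).1 (hz _ hv0)
    rw [hamVF_ell23, linearisation_apply] at ha
    have a2 := congrArg (fun v : Vec 6 => v 2) ha
    simp [h0, h1] at a2
    have : t * (b * (p 4 ^ 2 + p 5 ^ 2)) = 0 := by
      rcases a2 with a2 | a2
      · rcases a2 with a2 | a2
        · rw [a2]; ring
        · linarith
      · nlinarith
    exact (mul_eq_zero.1 this).resolve_right (by positivity)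

/-- Here `X_G = -2bℓ₂₃ X_J`, so the critical combination is `2bℓ₂₃ J + G`. The argument is that of
the family `U = 0` with `U` and `W` exchanged; `b > 1` makes the square constant `w` positive. -/
theorem isEllipticPoint_of_w_eq_zero (hb : 1 < b) (hp : p ∈ phaseSpace)
    (h : (p 2 = 0 ∧ p 4 = 0 ∧ p 5 = 0) ∧ ¬ (p 0 = 0 ∧ p 1 = 0)) :
    IsEllipticPoint structureMatrix ell23 (gPro b) p := by
  obtain ⟨⟨h2, h4, h5⟩, hU⟩ := h
  have hUpos := sq_add_sq_pos hU
  have hJ : hamVF structureMatrix ell23 p ≠ 0 := fun h => hU (hamVF_ell23_eq_zero_iff.1 h).1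
  have hc : hamVF structureMatrix (gPro b) p =
      (-2 * b * p 3) • hamVF structureMatrix ell23 p := by
    rw [hamVF_gPro, hamVF_ell23]
    ext i
    fin_cases i <;> simp [h2, h4, h5] <;> ring
  have hLmem : ∀ v, v ∈ orbitSpace structureMatrix ell23 (gPro b) p ↔
      ∃ a : ℝ, a • hamVF structureMatrix ell23 p = v := by
    intro v
    rw [orbitSpace_eq_span hc, Submodule.mem_span_singleton]
  have hv0 : !₂[0, 0, 0, 0, p 0, p 1] ∈ commonKernel structureMatrix ell23 (gPro b) p := by
    rw [mem_commonKernel_iff hp]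
    simp [h2, h4, h5]
    ring
  refine isElliptic_of_sq (s := 2 * b * p 3) (t := 1)
    (w := 4 * b * ((b - 1) * (p 0 ^ 2 + p 1 ^ 2) + b * p 3 ^ 2))
    (by have : 0 ≤ b * p 3 ^ 2 := mul_nonneg (by linarith) (sq_nonneg _)
        have : 0 < (b - 1) * (p 0 ^ 2 + p 1 ^ 2) := mul_pos (by linarith) hUpos
        exact mul_pos (by linarith) (by linarith)) hJ hc ?_ ?_ ?_ ?_ ?_ ?_
  · rw [hamVF_comb]
    ext i
    fin_cases i <;> simp [h2, h4, h5] <;> ring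
  · intro v hv
    rw [mem_commonKernel_iff hp] at hv ⊢
    obtain ⟨⟨-, hv2⟩, hv3, -⟩ := hv
    rw [linearisation_apply]
    simp [h2, h4, h5, hv3] at hv2 ⊢
    refine ⟨⟨by ring, by ring⟩, Or.inr (by ring)⟩
  · intro v hv
    obtain ⟨a, rfl⟩ := (hLmem v).1 hv
    convert Submodule.zero_mem _
    rw [hamVF_ell23, linearisation_apply]
    ext i
    fin_cases i <;> simp [h2, h4, h5] <;> ring
  · intro v hv
    rw [mem_commonKernel_iff hp] at hv
    obtain ⟨⟨hv1, hv2⟩, hv3, -⟩ := hv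
    simp [h2, h4, h5, hv3] at hv1 hv2
    rw [hLmem]
    refine ⟨4 * b * ((b - 1) * (p 0 ^ 2 + p 1 ^ 2) + b * p 3 ^ 2) * ((p 0 * v 1 - p 1 * v 0) /
      (p 0 ^ 2 + p 1 ^ 2)), ?_⟩
    rw [hamVF_ell23]
    simp only [linearisation_apply]
    ext i
    fin_cases i <;> simp [h2, h4, h5, hv3]
    · field_simp
      linear_combination
        -4 * ((b - 1) * (p 0 ^ 2 + p 1 ^ 2) + b * p 3 ^ 2) * p 0 * hv1
    · field_simp
      linear_combination
        -4 * ((b - 1) * (p 0 ^ 2 + p 1 ^ 2) + b * p 3 ^ 2) * p 1 * hv1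
    · linear_combination -4 * b * b * p 3 * hv2
    · linear_combination 4 * b * (b - 1) * p 1 * hv2
    · linear_combination -4 * b * (b - 1) * p 0 * hv2
  · refine ⟨_, hv0, fun hm => hU ?_⟩
    obtain ⟨a, ha⟩ := (hLmem _).1 hm
    rw [hamVF_ell23] at ha
    have ha := fun i => congrArg (fun v : Vec 6 => v i) ha
    have a0 := ha 4
    have a1 := ha 5
    simp [h4, h5] at a0 a1
    exact ⟨a0.symm, a1.symm⟩
  · intro s t hst hz
    rw [hamVF_comb] at hst
    have hst := fun i => congrArg (fun v : Vec 6 => v i) hst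
    have s0 := hst 0
    have s1 := hst 1
    simp [h2, h4, h5] at s0 s1
    have ht : t = 0 := by
      obtain ⟨a, ha⟩ := (hLmem _).1 (hz _ hv0)
      rw [hamVF_ell23, linearisation_apply] at ha
      have a2 := congrArg (fun v : Vec 6 => v 2) ha
      simp [h4, h5] at a2
      have : t * (b * (p 0 ^ 2 + p 1 ^ 2)) = 0 := by
        rcases a2 with a2 | a2
        · rcases a2 with a2 | a2
          · rw [a2]; ring
          · linarith
        · nlinarith
      exact (mul_eq_zero.1 this).resolve_right (by positivity)
    rw [ht] at s0 s1
    simp at s0 s1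
    exact ⟨by tauto, ht⟩

/-- The complex coordinate `a (v₀ + i v₁) + c (v₄ + i v₅)`. -/
noncomputable def complexCoord (a c : ℝ) : Vec 6 →ₗ[ℝ] ℂ where
  toFun v := ⟨a * v 0 + c * v 4, a * v 1 + c * v 5⟩
  map_add' v w := by apply Complex.ext <;> simp <;> ring
  map_smul' r v := by apply Complex.ext <;> simp <;> ring

theorem complexCoord_eq_zero {a c : ℝ} {v : Vec 6} (h : complexCoord a c v = 0) :
    a * v 0 + c * v 4 = 0 ∧ a * v 1 + c * v 5 = 0 :=
  ⟨congrArg Complex.re h, congrArg Complex.im h⟩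

theorem eq_of_ell23_zero (hp : p ∈ phaseSpace) (h : (p 0 = 0 ∧ p 1 = 0) ∧ p 4 = 0 ∧ p 5 = 0) :
    (p 2 ^ 2 = 1 ∧ p 3 = 0) ∨ (p 2 = 0 ∧ p 3 ^ 2 = 1) := by
  obtain ⟨⟨h0, h1⟩, h4, h5⟩ := h
  obtain ⟨e1, e2⟩ := (mem_phaseSpace_iff p).1 hp
  simp [h0, h1, h4, h5] at e1 e2
  rcases e2 with e2 | e2
  · exact Or.inr ⟨e2, by simpa [e2] using e1⟩
  · exact Or.inl ⟨by simpa [e2] using e1, e2⟩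

theorem hamVF_comb_eq_zero (h : (p 0 = 0 ∧ p 1 = 0) ∧ p 4 = 0 ∧ p 5 = 0) (s t : ℝ) :
    hamVF structureMatrix (comb ell23 (gPro b) s t) p = 0 := by
  obtain ⟨⟨h0, h1⟩, h4, h5⟩ := h
  rw [hamVF_comb]
  ext i
  fin_cases i <;> simp [h0, h1, h4, h5]

theorem rank_eq_zero_iff :
    rank structureMatrix ell23 (gPro b) p = 0 ↔ (p 0 = 0 ∧ p 1 = 0) ∧ p 4 = 0 ∧ p 5 = 0 := by
  constructor
  · intro h
    exact hamVF_ell23_eq_zero_iff.1 (hamVF_eq_zero_of_rank_eq_zero h)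
  · intro h
    refine rank_eq_zero (hamVF_ell23_eq_zero_iff.2 h) ?_
    rw [← comb_zero_one b]
    exact hamVF_comb_eq_zero h 0 1

theorem orbitSpace_eq_bot_of_fixed (h : (p 0 = 0 ∧ p 1 = 0) ∧ p 4 = 0 ∧ p 5 = 0) :
    orbitSpace structureMatrix ell23 (gPro b) p = ⊥ := by
  have := (rank_eq_zero_iff (b := b)).2 h
  rwa [rank, Submodule.finrank_eq_zero] at this

theorem mem_commonKernel_fixed_iff (hp : p ∈ phaseSpace)
    (h : (p 0 = 0 ∧ p 1 = 0) ∧ p 4 = 0 ∧ p 5 = 0) (v : Vec 6) :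
    v ∈ commonKernel structureMatrix ell23 (gPro b) p ↔ v 2 = 0 ∧ v 3 = 0 := by
  have hc := eq_of_ell23_zero hp h
  obtain ⟨⟨h0, h1⟩, h4, h5⟩ := h
  rw [mem_commonKernel_iff hp]
  simp only [h0, h1, h4, h5]
  constructor
  · rintro ⟨⟨e1, e2⟩, e3, e4⟩
    refine ⟨?_, e3⟩
    rcases hc with ⟨c, c'⟩ | ⟨c, c'⟩
    · have : p 2 ≠ 0 := by rintro h; simp [h] at c
      simpa [this] using e4
    · have : p 3 ≠ 0 := by rintro h; simp [h] at c'
      simpa [c, this] using e2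
  · rintro ⟨e2, e3⟩
    simp [e2, e3]

/-- Two linearly independent left eigenvectors `(a, c)` and `(a', c')` of the complex `2 × 2`
linearisation diagonalise it. -/
theorem isTransverseEigenvalue_fixed_iff (hp : p ∈ phaseSpace)
    (h : (p 0 = 0 ∧ p 1 = 0) ∧ p 4 = 0 ∧ p 5 = 0) {s t a c a' c' : ℝ} {μ κ : ℂ}
    (hdet : a * c' - c * a' ≠ 0)
    (hF : ActsBy (commonKernel structureMatrix ell23 (gPro b) p)
      (linearisation structureMatrix ell23 (gPro b) p s t) (complexCoord a c) μ)
    (hG : ActsBy (commonKernel structureMatrix ell23 (gPro b) p)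
      (linearisation structureMatrix ell23 (gPro b) p s t) (complexCoord a' c') κ) (z : ℂ) :
    IsTransverseEigenvalue structureMatrix ell23 (gPro b) p s t z ↔
      z = μ ∨ z = starRingEnd ℂ μ ∨ z = κ ∨ z = starRingEnd ℂ κ := by
  refine isTransverseEigenvalue_iff_of_actsBy (orbitSpace_eq_bot_of_fixed h) ?_ hF hG ?_ ?_ ?_ z
  · intro v hv
    rw [mem_commonKernel_fixed_iff hp h] at hv ⊢
    obtain ⟨⟨h0, h1⟩, h4, h5⟩ := h
    rw [linearisation_apply]
    simp [h0, h1, h4, h5]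
  · intro v hv hFv hGv
    obtain ⟨v2, v3⟩ := (mem_commonKernel_fixed_iff hp h v).1 hv
    obtain ⟨f1, f2⟩ := complexCoord_eq_zero hFv
    obtain ⟨g1, g2⟩ := complexCoord_eq_zero hGv
    have v0 : v 0 = 0 := mul_left_cancel₀ hdet (by linear_combination c' * f1 - c * g1)
    have v1 : v 1 = 0 := mul_left_cancel₀ hdet (by linear_combination c' * f2 - c * g2)
    have v4 : v 4 = 0 := mul_left_cancel₀ hdet (by linear_combination a * g1 - a' * f1)
    have v5 : v 5 = 0 := mul_left_cancel₀ hdet (by linear_combination a * g2 - a' * f2)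
    ext i
    fin_cases i <;> simp [v0, v1, v2, v3, v4, v5]
  · intro y
    -- Cramer's rule: `d` is the inverse determinant, and the vector below solves `F v = y`, `G v =
    -- 0`.
    obtain ⟨d, hd⟩ : ∃ d, d * (a * c' - c * a') = 1 := ⟨_, inv_mul_cancel₀ hdet⟩
    refine ⟨d • !₂[c' * y.re, c' * y.im, 0, 0, -a' * y.re, -a' * y.im],
      (mem_commonKernel_fixed_iff hp h _).2 (by simp), ?_, ?_⟩
    · apply Complex.ext <;> simp [complexCoord]
      · linear_combination y.re * hd
      · linear_combination y.im * hd
    · apply Complex.ext <;> simp [complexCoord] <;> exact Or.inr (by ring)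
  · intro y
    obtain ⟨d, hd⟩ : ∃ d, d * (a * c' - c * a') = 1 := ⟨_, inv_mul_cancel₀ hdet⟩
    refine ⟨d • !₂[-c * y.re, -c * y.im, 0, 0, a * y.re, a * y.im],
      (mem_commonKernel_fixed_iff hp h _).2 (by simp), ?_, ?_⟩
    · apply Complex.ext <;> simp [complexCoord] <;> exact Or.inr (by ring)
    · apply Complex.ext <;> simp [complexCoord]
      · linear_combination y.re * hd
      · linear_combination y.im * hd

/-- Two coordinate vectors suffice as tests: their images give `s = 0`, `t ℓ₁₄ = 0` and `t b ℓ₂₃ =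
0`, and at a fixed point `ℓ₁₄` and `ℓ₂₃` are not both zero. -/
theorem eq_zero_of_linearisation_fixed (hb : 1 < b) (hp : p ∈ phaseSpace)
    (h : (p 0 = 0 ∧ p 1 = 0) ∧ p 4 = 0 ∧ p 5 = 0) (s t : ℝ)
    (hst : ∀ u ∈ commonKernel structureMatrix ell23 (gPro b) p,
      linearisation structureMatrix ell23 (gPro b) p s t u ∈
        orbitSpace structureMatrix ell23 (gPro b) p) : s = 0 ∧ t = 0 := by
  have hc := eq_of_ell23_zero hp h
  simp only [orbitSpace_eq_bot_of_fixed h, Submodule.mem_bot, mem_commonKernel_fixed_iff hp h,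
    linearisation_apply] at hst
  have h1 := hst !₂[1, 0, 0, 0, 0, 0] (by simp)
  have h2 := hst !₂[0, 0, 0, 0, 1, 0] (by simp)
  have a1 := congrArg (fun v : Vec 6 => v 1) h1
  have a0 := congrArg (fun v : Vec 6 => v 0) h2
  have a5 := congrArg (fun v : Vec 6 => v 5) h2
  simp at a0 a1 a5
  refine ⟨a5, ?_⟩
  rw [a5] at a1
  have hb0 : b ≠ 0 := by linarith
  rcases hc with ⟨c, -⟩ | ⟨-, c⟩
  · have : p 2 ≠ 0 := by rintro h; simp [h] at c
    tauto
  · have : p 3 ≠ 0 := by rintro h; simp [h] at c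
    simp at a1
    tauto

theorem isTransverseEigenvalue_ellipticElliptic (hp : p ∈ phaseSpace)
    (h : (p 0 = 0 ∧ p 1 = 0) ∧ p 4 = 0 ∧ p 5 = 0) (h2 : p 2 = 0) (s t : ℝ) (z : ℂ) :
    IsTransverseEigenvalue structureMatrix ell23 (gPro b) p s t z ↔
      z = ⟨0, s - 2 * t * b * p 3⟩ ∨ z = starRingEnd ℂ ⟨0, s - 2 * t * b * p 3⟩ ∨
        z = ⟨0, s⟩ ∨ z = starRingEnd ℂ ⟨0, s⟩ := by
  refine isTransverseEigenvalue_fixed_iff hp h (a := 1) (c := 0) (a' := 0) (c' := 1) (by norm_num)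
    ?_ ?_ z <;>
  · intro v hv
    obtain ⟨v2, v3⟩ := (mem_commonKernel_fixed_iff hp h v).1 hv
    obtain ⟨⟨h0, h1⟩, h4, h5⟩ := h
    rw [linearisation_apply]
    apply Complex.ext <;> simp [complexCoord, h0, h1, h2, h4, h5, v2, v3] <;> ring

/-- With `V = v₀ + i v₁` and `V' = v₄ + i v₅`, the linearisation sends `V` to `isV + 2tℓ₁₄V'` and
`V'` to `2t(b-1)ℓ₁₄V + isV'`; its left eigenvectors are `V' ± √(b-1) V`. -/
theorem isTransverseEigenvalue_focusFocus (hb : 1 < b) (hp : p ∈ phaseSpace)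
    (h : (p 0 = 0 ∧ p 1 = 0) ∧ p 4 = 0 ∧ p 5 = 0) (h3 : p 3 = 0) (s t : ℝ) (z : ℂ) :
    IsTransverseEigenvalue structureMatrix ell23 (gPro b) p s t z ↔
      z = ⟨2 * t * p 2 * √(b - 1), s⟩ ∨ z = starRingEnd ℂ ⟨2 * t * p 2 * √(b - 1), s⟩ ∨
        z = ⟨-(2 * t * p 2 * √(b - 1)), s⟩ ∨
          z = starRingEnd ℂ ⟨-(2 * t * p 2 * √(b - 1)), s⟩ := by
  have hk : √(b - 1) ^ 2 = b - 1 := Real.sq_sqrt (by linarith)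
  have hk0 : 0 < √(b - 1) := Real.sqrt_pos.2 (by linarith)
  refine isTransverseEigenvalue_fixed_iff hp h (a := √(b - 1)) (c := 1) (a' := -√(b - 1))
    (c' := 1) (by linarith) ?_ ?_ z
  · intro v hv
    obtain ⟨v2, v3⟩ := (mem_commonKernel_fixed_iff hp h v).1 hv
    obtain ⟨⟨h0, h1⟩, h4, h5⟩ := h
    rw [linearisation_apply]
    apply Complex.ext <;> simp [complexCoord, h0, h1, h3, h4, h5, v2, v3]
    · linear_combination -2 * t * p 2 * v 0 * hk
    · linear_combination -2 * t * p 2 * v 1 * hk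
  · intro v hv
    obtain ⟨v2, v3⟩ := (mem_commonKernel_fixed_iff hp h v).1 hv
    obtain ⟨⟨h0, h1⟩, h4, h5⟩ := h
    rw [linearisation_apply]
    apply Complex.ext <;> simp [complexCoord, h0, h1, h3, h4, h5, v2, v3]
    · linear_combination -2 * t * p 2 * v 0 * hk
    · linear_combination -2 * t * p 2 * v 1 * hk

theorem isEllipticPoint_of_fixed (hb : 1 < b) (hp : p ∈ phaseSpace)
    (h : (p 0 = 0 ∧ p 1 = 0) ∧ p 4 = 0 ∧ p 5 = 0) (h2 : p 2 = 0) (h3 : p 3 ^ 2 = 1) :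
    IsEllipticPoint structureMatrix ell23 (gPro b) p := by
  have hr := (rank_eq_zero_iff (b := b)).2 h
  -- This choice of `(s, t)` gives `s - 2tbℓ₂₃ = 1 + ℓ₂₃² = 2`, so the eigenvalues `±2i, ±i` are
  -- distinct.
  have hz := isTransverseEigenvalue_ellipticElliptic (b := b) hp h h2 1 (-p 3 / (2 * b))
  have hs : (1 : ℝ) - 2 * (-p 3 / (2 * b)) * b * p 3 = 2 := by
    field_simp
    linarith
  rw [hs] at hz
  have hreg := isRegularComb_of_actsBy hr (hamVF_comb_eq_zero h _ _) hz (by norm_num) (by norm_num)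
    (by simp [Complex.ext_iff]) (by simp [Complex.ext_iff]; norm_num)
  refine ⟨by rw [IsSingular, hr]; norm_num,
    ⟨fun s t _ => eq_zero_of_linearisation_fixed hb hp h s t, _, _, hreg⟩, _, _, hreg, ?_⟩
  intro z h
  rcases (hz z).1 h with rfl | rfl | rfl | rfl <;> simp

theorem isFocusFocusPoint_of_fixed (hb : 1 < b) (hp : p ∈ phaseSpace)
    (h : (p 0 = 0 ∧ p 1 = 0) ∧ p 4 = 0 ∧ p 5 = 0) (h2 : p 2 ^ 2 = 1) (h3 : p 3 = 0) :
    IsFocusFocusPoint structureMatrix ell23 (gPro b) p := by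
  have hr := (rank_eq_zero_iff (b := b)).2 h
  have hz := isTransverseEigenvalue_focusFocus hb hp h h3 1 1
  have hα : 2 * 1 * p 2 * √(b - 1) ≠ 0 := by
    have hk0 : 0 < √(b - 1) := Real.sqrt_pos.2 (by linarith)
    have : p 2 ≠ 0 := by rintro h; simp [h] at h2
    positivity
  set α := 2 * 1 * p 2 * √(b - 1)
  have hne : α ≠ -α := fun h => hα (by linarith)
  have hreg := isRegularComb_of_actsBy hr (hamVF_comb_eq_zero h _ _) hz (by norm_num) (by norm_num)
    (by simp [Complex.ext_iff, hne]) (by simp [Complex.ext_iff, hne])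
  refine ⟨hr, ⟨fun s t _ => eq_zero_of_linearisation_fixed hb hp h s t, _, _, hreg⟩, _, _, hreg,
    α, 1, hα, one_ne_zero, fun z => ?_⟩
  rw [hz]
  simp only [Complex.ext_iff, Complex.conj_re, Complex.conj_im]
  tauto

theorem isFocusFocusPoint_iff (hb : 1 < b) (hp : p ∈ phaseSpace) :
    IsFocusFocusPoint structureMatrix ell23 (gPro b) p ↔
      ((p 0 = 0 ∧ p 1 = 0) ∧ p 4 = 0 ∧ p 5 = 0) ∧ p 2 ^ 2 = 1 ∧ p 3 = 0 := by
  constructor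
  · rintro ⟨hr, -, s, t, -, α, β, hα, -, hz⟩
    have h := rank_eq_zero_iff.1 hr
    refine ⟨h, (eq_of_ell23_zero hp h).resolve_right ?_⟩
    rintro ⟨h2, -⟩
    -- At the fixed points with `ℓ₁₄ = 0` every combination has purely imaginary eigenvalues, so `α
    -- + iβ` cannot occur with `α ≠ 0`.
    refine hα ?_
    have := (hz ⟨α, β⟩).2 (by simp)
    rw [isTransverseEigenvalue_ellipticElliptic hp h h2] at this
    rcases this with h | h | h | h <;> simpa using congrArg Complex.re h
  · rintro ⟨h, h2, h3⟩
    exact isFocusFocusPoint_of_fixed hb hp h h2 h3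

theorem singular_point (hb : 1 < b) (hp : p ∈ phaseSpace)
    (h : IsSingular structureMatrix ell23 (gPro b) p) :
    IsNondegenerate structureMatrix ell23 (gPro b) p ∧
      (IsEllipticPoint structureMatrix ell23 (gPro b) p ∨
        IsFocusFocusPoint structureMatrix ell23 (gPro b) p) := by
  have key : IsEllipticPoint structureMatrix ell23 (gPro b) p ∨
      IsFocusFocusPoint structureMatrix ell23 (gPro b) p := by
    rcases singular_cases hb hp h with h | h | h
    · rcases eq_of_ell23_zero hp h with ⟨h2, h3⟩ | ⟨h2, h3⟩
      · exact Or.inr (isFocusFocusPoint_of_fixed hb hp h h2 h3)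
      · exact Or.inl (isEllipticPoint_of_fixed hb hp h h2 h3)
    · exact Or.inl (isEllipticPoint_of_u_eq_zero hb hp h)
    · exact Or.inl (isEllipticPoint_of_w_eq_zero hb hp h)
  exact ⟨key.elim (fun h => h.2.1) (fun h => h.2.1), key⟩

end Prolate

/-! ### Topology of the phase space, the circle action and the semi-toric property. -/

namespace Prolate

open PoissonSystem

/-- The linear isomorphism `(X, Y) ↦ L`. -/
noncomputable def ofXY (q : Vec 3 × Vec 3) : Vec 6 :=
  !₂[q.1 0 + q.2 0, q.1 1 - q.2 1, q.1 2 + q.2 2, q.1 2 - q.2 2, -(q.1 1 + q.2 1), q.1 0 - q.2 0]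

theorem continuous_ofXY : Continuous ofXY := by
  refine (PiLp.continuous_toLp 2 _).comp (continuous_pi fun i => ?_)
  fin_cases i <;> simp <;> fun_prop

theorem phaseSpace_eq_image :
    phaseSpace = ofXY '' (Metric.sphere (0 : Vec 3) (1 / 2) ×ˢ Metric.sphere (0 : Vec 3) (1 / 2)) := by
  ext p
  constructor
  · rintro ⟨h1, h2⟩
    refine ⟨(vecX p, vecY p), ⟨h1, h2⟩, ?_⟩
    ext i
    fin_cases i <;> simp [ofXY, vecX, vecY] <;> ring
  · rintro ⟨⟨x, y⟩, ⟨h1, h2⟩, rfl⟩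
    have hx : vecX (ofXY (x, y)) = x := by
      ext i
      fin_cases i <;> (simp [ofXY, vecX]; try ring)
    have hy : vecY (ofXY (x, y)) = y := by
      ext i
      fin_cases i <;> (simp [ofXY, vecY]; try ring)
    exact ⟨by rwa [hx], by rwa [hy]⟩

theorem isConnected_phaseSpace : IsConnected phaseSpace := by
  have h : IsConnected (Metric.sphere (0 : Vec 3) (1 / 2)) := by
    refine isConnected_sphere ?_ 0 (by norm_num)
    rw [← Module.finrank_eq_rank]
    simp
  rw [phaseSpace_eq_image]
  exact (h.prod h).image _ continuous_ofXY.continuousOn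

theorem isCompact_phaseSpace : IsCompact phaseSpace := by
  rw [phaseSpace_eq_image]
  exact ((isCompact_sphere _ _).prod (isCompact_sphere _ _)).image continuous_ofXY

/-- The two Casimirs, normalised to vanish on the phase space. -/
noncomputable def casimirs (L : Vec 6) : Vec 2 :=
  !₂[L 0 ^ 2 + L 1 ^ 2 + L 2 ^ 2 + L 3 ^ 2 + L 4 ^ 2 + L 5 ^ 2 - 1,
    L 0 * L 5 - L 1 * L 4 + L 2 * L 3]

theorem casimirs_eq_zero_iff (p : Vec 6) : casimirs p = 0 ↔ p ∈ phaseSpace := by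
  rw [mem_phaseSpace_iff]
  constructor
  · intro h
    have h0 := congrArg (fun v : Vec 2 => v 0) h
    have h1 := congrArg (fun v : Vec 2 => v 1) h
    simp [casimirs] at h0 h1
    exact ⟨by linarith, h1⟩
  · rintro ⟨h0, h1⟩
    ext i
    fin_cases i <;> simp [casimirs]
    · linarith
    · exact h1

theorem contDiff_coord {n : WithTop ℕ∞} (i : Fin 6) : ContDiff ℝ n (fun q : Vec 6 => q i) :=
  (EuclideanSpace.proj i : Vec 6 →L[ℝ] ℝ).contDiff

theorem contDiff_casimirs : ContDiff ℝ ∞ casimirs := by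
  have := contDiff_coord (n := ∞)
  rw [contDiff_euclidean]
  intro i
  fin_cases i <;> simp [casimirs] <;> fun_prop

theorem fderiv_casimirs_apply (p v : Vec 6) :
    fderiv ℝ casimirs p v =
      !₂[2 * (p 0 * v 0 + p 1 * v 1 + p 2 * v 2 + p 3 * v 3 + p 4 * v 4 + p 5 * v 5),
        p 5 * v 0 - p 4 * v 1 + p 3 * v 2 + p 2 * v 3 - p 1 * v 4 + p 0 * v 5] := by
  have h : ∀ i : Fin 6, HasFDerivAt (fun q : Vec 6 => q i)
      (EuclideanSpace.proj i : Vec 6 →L[ℝ] ℝ) p :=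
    fun i => (EuclideanSpace.proj i : Vec 6 →L[ℝ] ℝ).hasFDerivAt
  have k0 := ((((((h 0).pow 2).add ((h 1).pow 2)).add ((h 2).pow 2)).add ((h 3).pow 2)).add
    ((h 4).pow 2)).add ((h 5).pow 2) |>.sub_const 1
  have k1 := (((h 0).mul (h 5)).sub ((h 1).mul (h 4))).add ((h 2).mul (h 3))
  have hd : DifferentiableAt ℝ casimirs p := contDiff_casimirs.differentiable (by simp) p
  ext i
  rw [fderiv_apply_coord hd]
  fin_cases i
  · refine (congrArg (fun A => A v) k0.fderiv).trans ?_
    simp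
    ring
  · refine (congrArg (fun A => A v) k1.fderiv).trans ?_
    simp
    ring

theorem isSymplecticManifold_phaseSpace : IsSymplecticManifold structureMatrix phaseSpace 4 where
  poisson := isPoisson_structureMatrix
  connected := isConnected_phaseSpace
  submanifold p hp := by
    refine ⟨2, rfl, Set.univ, isOpen_univ, trivial, casimirs, contDiff_casimirs.contDiffOn, ?_, ?_,
      ?_⟩
    · ext q
      simp [casimirs_eq_zero_iff]
    · intro y
      obtain ⟨h1, h2⟩ := (mem_phaseSpace_iff p).1 hp
      -- On the phase space the Casimir gradients `2p` and `(p₅, -p₄, p₃, p₂, -p₁, p₀)` are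
      -- orthogonal, of norms `2` and `1`, so a suitable combination of them is a preimage of `y`.
      refine ⟨!₂[y 0 / 2 * p 0 + y 1 * p 5, y 0 / 2 * p 1 - y 1 * p 4, y 0 / 2 * p 2 + y 1 * p 3,
        y 0 / 2 * p 3 + y 1 * p 2, y 0 / 2 * p 4 - y 1 * p 1, y 0 / 2 * p 5 + y 1 * p 0], ?_⟩
      rw [fderiv_casimirs_apply]
      ext i
      fin_cases i <;> simp
      · linear_combination y 0 * h1 + 4 * y 1 * h2
      · linear_combination y 1 * h1 + y 0 * h2
    · ext v
      rw [mem_charSpace_iff hp, LinearMap.mem_ker, ContinuousLinearMap.coe_coe,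
        fderiv_casimirs_apply]
      constructor
      · intro h
        have h0 := congrArg (fun v : Vec 2 => v 0) h
        have h1 := congrArg (fun v : Vec 2 => v 1) h
        simp at h0 h1
        exact ⟨h0, h1⟩
      · rintro ⟨h0, h1⟩
        rw [h0, h1]
        ext i
        fin_cases i <;> simp

/-- The simultaneous rotation of the planes `(ℓ₁₂, ℓ₁₃)` and `(ℓ₂₄, ℓ₃₄)`. -/
noncomputable def rotate (z : Circle) (p : Vec 6) : Vec 6 :=
  !₂[(z : ℂ).re * p 0 - (z : ℂ).im * p 1, (z : ℂ).im * p 0 + (z : ℂ).re * p 1, p 2, p 3,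
    (z : ℂ).re * p 4 - (z : ℂ).im * p 5, (z : ℂ).im * p 4 + (z : ℂ).re * p 5]

theorem circle_re_sq_add_im_sq (z : Circle) : (z : ℂ).re ^ 2 + (z : ℂ).im ^ 2 = 1 := by
  have := Circle.normSq_coe z
  rw [Complex.normSq_apply] at this
  linarith

theorem rotate_mem (z : Circle) {p : Vec 6} (hp : p ∈ phaseSpace) : rotate z p ∈ phaseSpace := by
  rw [mem_phaseSpace_iff] at hp ⊢
  obtain ⟨h1, h2⟩ := hp
  have hz := circle_re_sq_add_im_sq z
  simp [rotate]
  constructor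
  · linear_combination h1 + (p 0 ^ 2 + p 1 ^ 2 + p 4 ^ 2 + p 5 ^ 2) * hz
  · linear_combination h2 + (p 0 * p 5 - p 1 * p 4) * hz

theorem continuous_rotate : Continuous fun q : Circle × Vec 6 => rotate q.1 q.2 := by
  refine (PiLp.continuous_toLp 2 _).comp (continuous_pi fun i => ?_)
  have hre : Continuous fun q : Circle × Vec 6 => (q.1 : ℂ).re := by fun_prop
  have him : Continuous fun q : Circle × Vec 6 => (q.1 : ℂ).im := by fun_prop
  fin_cases i <;> simp <;> fun_prop

theorem hasDerivAt_rotate (p : Vec 6) (t : ℝ) :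
    HasDerivAt (fun s : ℝ => rotate (Circle.exp s) p)
      (hamVF structureMatrix ell23 (rotate (Circle.exp t) p)) t := by
  have e : (fun s : ℝ => rotate (Circle.exp s) p) = fun s =>
      Real.cos s • (!₂[p 0, p 1, 0, 0, p 4, p 5] : Vec 6)
        + Real.sin s • (!₂[-p 1, p 0, 0, 0, -p 5, p 4] : Vec 6)
        + (!₂[0, 0, p 2, p 3, 0, 0] : Vec 6) := by
    funext s
    ext i
    fin_cases i <;> simp [rotate, Complex.exp_ofReal_mul_I_re, Complex.exp_ofReal_mul_I_im] <;> ring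
  rw [e]
  refine ((((Real.hasDerivAt_cos t).smul_const _).add
    ((Real.hasDerivAt_sin t).smul_const _)).add_const _).congr_deriv ?_
  rw [hamVF_ell23]
  ext i
  fin_cases i <;> simp [rotate, Complex.exp_ofReal_mul_I_re, Complex.exp_ofReal_mul_I_im] <;> ring

theorem generatesCircleAction_ell23 : GeneratesCircleAction structureMatrix phaseSpace ell23 := by
  refine ⟨fun z p => ⟨rotate z p, rotate_mem z p.2⟩, ?_, ?_, ?_, ?_, fun p t => ?_⟩
  · exact (continuous_rotate.comp
      (continuous_fst.prodMk (continuous_subtype_val.comp continuous_snd))).subtype_mk _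
  · intro p
    apply Subtype.ext
    ext i
    fin_cases i <;> simp [rotate]
  · intro z w p
    apply Subtype.ext
    ext i
    fin_cases i <;> simp [rotate] <;> ring
  · intro z hz
    -- Effectiveness: the first two coordinates of the rotated point are the real and imaginary
    -- parts of `z`.
    have hmem : (!₂[1, 0, 0, 0, 0, 0] : Vec 6) ∈ phaseSpace := by
      rw [mem_phaseSpace_iff]
      simp
    have h := congrArg Subtype.val (hz ⟨_, hmem⟩)
    have h0 := congrArg (fun v : Vec 6 => v 0) h
    have h1 := congrArg (fun v : Vec 6 => v 1) h
    simp [rotate] at h0 h1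
    apply Circle.ext
    apply Complex.ext <;> simp [h0, h1]
  · exact hasDerivAt_rotate p t

theorem hausdorffMeasure_range_eq_zero {f : Vec 3 → Vec 6} (hf : ContDiff ℝ 1 f) :
    MeasureTheory.Measure.hausdorffMeasure (4 : ℝ) (Set.range f) = 0 := by
  have h : dimH (Set.range f) < ((4 : NNReal) : ENNReal) := by
    refine hf.dimH_range_le.trans_lt ?_
    simp
    norm_num
  exact_mod_cast hausdorffMeasure_of_dimH_lt h

/-- By `singular_cases` the singular set lies in three smooth images of `ℝ³`, which have dimension
at most three. The first subspace is only a plane; it is parametrised with a spare variable. -/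
theorem hausdorffMeasure_singular {b : ℝ} (hb : 1 < b) :
    MeasureTheory.Measure.hausdorffMeasure (4 : ℝ)
      {p ∈ phaseSpace | IsSingular structureMatrix ell23 (gPro b) p} = 0 := by
  have hc : ∀ i : Fin 3, ContDiff ℝ 1 (fun q : Vec 3 => q i) :=
    fun i => (EuclideanSpace.proj i : Vec 3 →L[ℝ] ℝ).contDiff
  have c1 : ContDiff ℝ 1 (fun q : Vec 3 => (!₂[0, 0, q 0, q 1, 0, 0] : Vec 6)) := by
    rw [contDiff_euclidean]
    intro i
    fin_cases i <;> simp <;> fun_prop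
  have c2 : ContDiff ℝ 1 (fun q : Vec 3 => (!₂[0, 0, 0, q 0, q 1, q 2] : Vec 6)) := by
    rw [contDiff_euclidean]
    intro i
    fin_cases i <;> simp <;> fun_prop
  have c3 : ContDiff ℝ 1 (fun q : Vec 3 => (!₂[q 0, q 1, 0, q 2, 0, 0] : Vec 6)) := by
    rw [contDiff_euclidean]
    intro i
    fin_cases i <;> simp <;> fun_prop
  refine MeasureTheory.measure_mono_null ?_
    (MeasureTheory.measure_union_null (hausdorffMeasure_range_eq_zero c1)
      (MeasureTheory.measure_union_null (hausdorffMeasure_range_eq_zero c2)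
        (hausdorffMeasure_range_eq_zero c3)))
  rintro p ⟨hp, hs⟩
  rcases singular_cases hb hp hs with ⟨⟨h0, h1⟩, h4, h5⟩ | ⟨⟨⟨h0, h1⟩, h2⟩, -⟩ | ⟨⟨h2, h4, h5⟩, -⟩
  · refine Or.inl ⟨!₂[p 2, p 3, 0], ?_⟩
    ext i
    fin_cases i <;> simp [*]
  · refine Or.inr (Or.inl ⟨!₂[p 3, p 4, p 5], ?_⟩)
    ext i
    fin_cases i <;> simp [*]
  · refine Or.inr (Or.inr ⟨!₂[p 0, p 1, p 3], ?_⟩)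
    ext i
    fin_cases i <;> simp [*]

theorem bracket_ell23_gPro (b : ℝ) (p : Vec 6) :
    bracket structureMatrix ell23 (gPro b) p = 0 := by
  rw [bracket, hamVF_gPro, ← comb_one_zero b, (hasGradientAt_comb b 1 0 p).gradient]
  simp [PiLp.inner_apply, Fin.sum_univ_six]

theorem isGeneralisedSemitoric {b : ℝ} (hb : 1 < b) :
    IsGeneralisedSemitoric structureMatrix phaseSpace ell23 (gPro b) where
  integrable :=
    { symplectic := isSymplecticManifold_phaseSpace
      smooth_J := contDiff_coord 3
      smooth_H := by
        have := contDiff_coord (n := ∞)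
        unfold gPro
        fun_prop
      commute := fun p _ => bracket_ell23_gPro b p
      independent := hausdorffMeasure_singular hb }
  proper C hC :=
    isCompact_phaseSpace.inter_right (hC.isClosed.preimage (contDiff_coord (n := 0) 3).continuous)
  circleAction := generatesCircleAction_ell23
  singularities _ hp hs := singular_point hb hp hs

end Prolate

/-! ### The doubly pinched fibre. -/

namespace Prolate

open PoissonSystem

theorem exists_circle {x y : ℝ} (h : x ^ 2 + y ^ 2 = 1) :
    ∃ z : Circle, (z : ℂ).re = x ∧ (z : ℂ).im = y := by
  refine ⟨⟨⟨x, y⟩, mem_sphere_zero_iff_norm.2 ?_⟩, rfl, rfl⟩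
  rw [← sq_eq_sq₀ (norm_nonneg _) zero_le_one, Complex.sq_norm,
    Complex.normSq_mk]
  linarith

theorem circle_sq_eq_one_iff (z : Circle) : z ^ 2 = 1 ↔ (z : ℂ).im = 0 := by
  have hz := circle_re_sq_add_im_sq z
  constructor
  · intro h
    have h := congrArg (fun w : Circle => (w : ℂ)) h
    have h := congrArg Complex.re h
    simp [sq] at h
    nlinarith
  · intro h
    apply Circle.ext
    rw [h] at hz
    apply Complex.ext <;> simp [sq, h]
    linarith

theorem circle_ext {z w : Circle} (h1 : (z : ℂ).re = (w : ℂ).re) (h2 : (z : ℂ).im = (w : ℂ).im) :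
    z = w :=
  Circle.ext (Complex.ext h1 h2)

/-- The parametrisation of the fibre over `(0, 1)` by the torus. -/
noncomputable def fibreMap (b : ℝ) (q : Circle × Circle) : Vec 6 :=
  !₂[(q.1 : ℂ).im / √b * (q.2 : ℂ).re, (q.1 : ℂ).im / √b * (q.2 : ℂ).im, (q.1 : ℂ).re, 0,
    √(b - 1) * |(q.1 : ℂ).im| / √b * (q.2 : ℂ).re, √(b - 1) * |(q.1 : ℂ).im| / √b * (q.2 : ℂ).im]

theorem continuous_fibreMap (b : ℝ) : Continuous (fibreMap b) := by
  refine (PiLp.continuous_toLp 2 _).comp (continuous_pi fun i => ?_)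
  have h1 : Continuous fun q : Circle × Circle => (q.1 : ℂ).re := by fun_prop
  have h2 : Continuous fun q : Circle × Circle => (q.1 : ℂ).im := by fun_prop
  have h3 : Continuous fun q : Circle × Circle => (q.2 : ℂ).re := by fun_prop
  have h4 : Continuous fun q : Circle × Circle => (q.2 : ℂ).im := by fun_prop
  fin_cases i <;> simp <;> fun_prop

/-- Subtracting the first Casimir equation from `G_pro = 1` at `ℓ₂₃ = 0` gives `|W|² = (b-1)|U|²`,
and the second becomes `U ∥ W`. -/
theorem mem_fibre_iff {b : ℝ} {p : Vec 6} :
    (p ∈ phaseSpace ∧ (ell23 p, gPro b p) = ((0 : ℝ), (1 : ℝ))) ↔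
      p 3 = 0 ∧ b * (p 0 ^ 2 + p 1 ^ 2) + p 2 ^ 2 = 1 ∧
        p 4 ^ 2 + p 5 ^ 2 = (b - 1) * (p 0 ^ 2 + p 1 ^ 2) ∧ p 0 * p 5 = p 1 * p 4 := by
  rw [mem_phaseSpace_iff, Prod.mk.injEq, ell23, gPro]
  constructor
  · rintro ⟨⟨h1, h2⟩, h3, h4⟩
    rw [h3] at h1 h2
    exact ⟨h3, by linarith, by linarith, by linarith⟩
  · rintro ⟨h3, h4, h5, h6⟩
    rw [h3]
    exact ⟨⟨by linarith, by linarith⟩, rfl, by linarith⟩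

theorem fibreMap_mem {b : ℝ} (hb : 1 < b) (q : Circle × Circle) :
    fibreMap b q ∈ phaseSpace ∧
      (ell23 (fibreMap b q), gPro b (fibreMap b q)) = ((0 : ℝ), (1 : ℝ)) := by
  have h1 := circle_re_sq_add_im_sq q.1
  have h2 := circle_re_sq_add_im_sq q.2
  have hk : √(b - 1) ^ 2 = b - 1 := Real.sq_sqrt (by linarith)
  have hb2 : √b ^ 2 = b := Real.sq_sqrt (by linarith)
  have hb0 : 0 < √b := Real.sqrt_pos.2 (by linarith)
  obtain ⟨r, hdiv, hr⟩ : ∃ r : ℝ, (∀ x, x / √b = x * r) ∧ b * r ^ 2 = 1 :=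
    ⟨(√b)⁻¹, fun x => div_eq_mul_inv x _, by rw [inv_pow, hb2]; field_simp⟩
  rw [mem_fibre_iff]
  simp only [fibreMap, hdiv]
  have ha := sq_abs (q.1 : ℂ).im
  refine ⟨rfl, ?_, ?_, ?_⟩ <;> simp
  · linear_combination h1 + b * (q.1 : ℂ).im ^ 2 * r ^ 2 * h2 + (q.1 : ℂ).im ^ 2 * hr
  · linear_combination ((q.2 : ℂ).re ^ 2 + (q.2 : ℂ).im ^ 2) * r ^ 2 *
      (|(q.1 : ℂ).im| ^ 2 * hk + (b - 1) * ha)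
  · ring

theorem fibreMap_eq_of_rel {b : ℝ} {x y : Circle × Circle} (h : pinchSetoid x y) :
    fibreMap b x = fibreMap b y := by
  rcases h with h | ⟨h1, h2⟩
  · rw [h]
  · rw [circle_sq_eq_one_iff] at h2
    have h3 := h2
    rw [h1] at h3
    ext i
    fin_cases i <;> simp [fibreMap, h3, h1]

/-- The absolute value in the `W`-part is what gives injectivity: off the pinch points `W` is a
positive multiple of `ζ` and so determines it, and `U` then determines `sin θ` with its sign.
Without it, `(sin θ, ζ)` and `(-sin θ, -ζ)` would have the same image. -/
theorem rel_of_fibreMap_eq {b : ℝ} (hb : 1 < b) {x y : Circle × Circle}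
    (h : fibreMap b x = fibreMap b y) : pinchSetoid x y := by
  have hk : 0 < √(b - 1) := Real.sqrt_pos.2 (by linarith)
  have hb0 : 0 < √b := Real.sqrt_pos.2 (by linarith)
  have hc := fun i => congrArg (fun v : Vec 6 => v i) h
  have e0 := hc 0
  have e1 := hc 1
  have e2 := hc 2
  have e4 := hc 4
  have e5 := hc 5
  simp [fibreMap] at e0 e1 e2 e4 e5
  have hx := circle_re_sq_add_im_sq x.1
  have hy := circle_re_sq_add_im_sq y.1
  have hsq : (x.1 : ℂ).im ^ 2 = (y.1 : ℂ).im ^ 2 := by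
    rw [e2] at hx
    linarith
  by_cases h0 : (x.1 : ℂ).im = 0
  · have h0' : (y.1 : ℂ).im = 0 := by
      rw [h0] at hsq
      exact pow_eq_zero_iff (two_ne_zero) |>.1 (by linarith)
    exact Or.inr ⟨circle_ext e2 (by rw [h0, h0']), (circle_sq_eq_one_iff _).2 h0⟩
  · have habs : |(x.1 : ℂ).im| = |(y.1 : ℂ).im| := sq_eq_sq_iff_abs_eq_abs _ _ |>.1 hsq
    have hne : √(b - 1) * |(x.1 : ℂ).im| / √b ≠ 0 := by positivity
    rw [← habs] at e4 e5
    have f1 := mul_left_cancel₀ hne e4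
    have f2 := mul_left_cancel₀ hne e5
    have hxy : x.2 = y.2 := circle_ext f1 f2
    have hz := circle_re_sq_add_im_sq x.2
    have him : (x.1 : ℂ).im / √b = (y.1 : ℂ).im / √b := by
      rw [← f1] at e0
      rw [← f2] at e1
      linear_combination (x.2 : ℂ).re * e0 + (x.2 : ℂ).im * e1 -
        ((x.1 : ℂ).im / √b - (y.1 : ℂ).im / √b) * hz
    have him := (div_left_inj' hb0.ne').1 him
    exact Or.inl (Prod.ext (circle_ext e2 him) hxy)

theorem exists_fibreMap_eq {b : ℝ} (hb : 1 < b) {p : Vec 6}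
    (hp : p ∈ phaseSpace ∧ (ell23 p, gPro b p) = ((0 : ℝ), (1 : ℝ))) :
    ∃ q, fibreMap b q = p := by
  obtain ⟨h3, h4, h5, h6⟩ := mem_fibre_iff.1 hp
  have hk2 : √(b - 1) ^ 2 = b - 1 := Real.sq_sqrt (by linarith)
  have hb2 : √b ^ 2 = b := Real.sq_sqrt (by linarith)
  have hk : 0 < √(b - 1) := Real.sqrt_pos.2 (by linarith)
  have hb0 : 0 < √b := Real.sqrt_pos.2 (by linarith)
  -- If `W = 0` then `U = 0` as well, and the point is a pinch point, where any second coordinate on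
  -- the torus will do.
  by_cases hW : p 4 = 0 ∧ p 5 = 0
  · have hU : p 0 = 0 ∧ p 1 = 0 := by
      by_contra hU
      have := mul_pos (sub_pos.2 hb) (sq_add_sq_pos hU)
      rw [← h5, hW.1, hW.2] at this
      simp at this
    rw [hU.1, hU.2] at h4
    obtain ⟨z, hz1, hz2⟩ := exists_circle (x := p 2) (y := 0) (by linarith)
    refine ⟨(z, 1), ?_⟩
    ext i
    fin_cases i <;> simp [fibreMap, hz1, hz2, hU.1, hU.2, hW.1, hW.2, h3]
  · have hWpos := sq_add_sq_pos hW
    obtain ⟨ρ, hρ, hρ2⟩ : ∃ ρ : ℝ, 0 < ρ ∧ ρ ^ 2 = p 4 ^ 2 + p 5 ^ 2 :=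
      ⟨_, Real.sqrt_pos.2 hWpos, Real.sq_sqrt hWpos.le⟩
    -- Parallelism gives `U = l W`, with `l` the projection coefficient; the relation between the
    -- lengths then forces `√(b-1) |l| = 1`.
    obtain ⟨l, hl0, hl1⟩ : ∃ l : ℝ, p 0 = l * p 4 ∧ p 1 = l * p 5 := by
      refine ⟨(p 0 * p 4 + p 1 * p 5) / (p 4 ^ 2 + p 5 ^ 2), ?_, ?_⟩ <;> field_simp
      · linear_combination p 5 * h6
      · linear_combination -p 4 * h6
    have hl : (√(b - 1) * |l|) ^ 2 = 1 := by
      rw [mul_pow, sq_abs, hk2]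
      rw [hl0, hl1] at h5
      apply mul_right_cancel₀ hWpos.ne'
      linear_combination -h5
    have hl : √(b - 1) * |l| = 1 := by
      have : 0 ≤ √(b - 1) * |l| := by positivity
      nlinarith
    -- Solving `U = (sin θ / √b) ζ` with `U = l W` and `W = ρ ζ` gives `sin θ = l ρ √b`, whose sign
    -- is that of `l`.
    obtain ⟨z, hz1, hz2⟩ := exists_circle (x := p 2) (y := l * ρ * √b) (by
      rw [hl0, hl1] at h4
      rw [mul_pow, mul_pow, hb2, hρ2]
      linear_combination h4)
    obtain ⟨ζ, hζ1, hζ2⟩ := exists_circle (x := p 4 / ρ) (y := p 5 / ρ) (by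
      rw [div_pow, div_pow, ← add_div, ← hρ2, div_self (by positivity)])
    have hA : |l * ρ * √b| = |l| * ρ * √b := by
      rw [abs_mul, abs_mul, abs_of_pos hρ, abs_of_pos hb0]
    refine ⟨(z, ζ), ?_⟩
    ext i
    fin_cases i <;> simp [fibreMap, hz1, hz2, hζ1, hζ2, h3, hl0, hl1, hA]
    · field_simp
    · field_simp
    · field_simp
      linear_combination p 4 * hl
    · field_simp
      linear_combination p 5 * hl

/-- The fibre over `(0, 1)` is a doubly pinched torus. -/
noncomputable def fibreHomeomorph {b : ℝ} (hb : 1 < b) : DoublyPinchedTorus ≃ₜ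
    {p : Vec 6 // p ∈ phaseSpace ∧ (ell23 p, gPro b p) = ((0 : ℝ), (1 : ℝ))} :=
  Continuous.homeoOfEquivCompactToT2 (f := Equiv.ofBijective
    (Quotient.lift (fun q => ⟨fibreMap b q, fibreMap_mem hb q⟩)
      fun _ _ h => Subtype.ext (fibreMap_eq_of_rel h))
    ⟨by
      rintro ⟨x⟩ ⟨y⟩ h
      exact Quotient.sound (rel_of_fibreMap_eq hb (congrArg Subtype.val h)),
    fun p => by
      obtain ⟨q, hq⟩ := exists_fibreMap_eq hb p.2
      exact ⟨Quotient.mk _ q, Subtype.ext hq⟩⟩)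
    (((continuous_fibreMap b).subtype_mk _).quotient_lift _)

theorem mk_mem_pinchPoints_iff (q : Circle × Circle) :
    Quotient.mk pinchSetoid q ∈ pinchPoints ↔ (q.1 : ℂ).im = 0 := by
  rw [← circle_sq_eq_one_iff]
  constructor
  · rintro ⟨z, w, hz, h⟩
    rcases Quotient.exact h with h | ⟨-, h⟩
    · rw [h]
      exact hz
    · exact h
  · intro h
    exact ⟨q.1, q.2, h, rfl⟩

theorem isFocusFocusPoint_fibreMap_iff {b : ℝ} (hb : 1 < b) (q : Circle × Circle) :
    IsFocusFocusPoint structureMatrix ell23 (gPro b) (fibreMap b q) ↔ (q.1 : ℂ).im = 0 := by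
  have hq := circle_re_sq_add_im_sq q.1
  rw [isFocusFocusPoint_iff hb (fibreMap_mem hb q).1]
  constructor
  · rintro ⟨-, h, -⟩
    simp [fibreMap] at h
    rcases h with h | h <;> rw [h] at hq <;> simpa using hq
  · intro h
    rw [h] at hq
    refine ⟨⟨⟨?_, ?_⟩, ?_, ?_⟩, ?_, ?_⟩ <;> simp [fibreMap, h]
    simpa using hq

theorem focusFocus_values {b : ℝ} (hb : 1 < b) :
    {c : ℝ × ℝ | ∃ p ∈ phaseSpace, IsFocusFocusPoint structureMatrix ell23 (gPro b) p ∧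
      (ell23 p, gPro b p) = c} = {((0 : ℝ), (1 : ℝ))} := by
  ext c
  constructor
  · rintro ⟨p, hp, hf, rfl⟩
    obtain ⟨⟨⟨h0, h1⟩, -⟩, h2, h3⟩ := (isFocusFocusPoint_iff hb hp).1 hf
    simp [ell23, gPro, h0, h1, h3, h2]
  · rintro rfl
    -- The parameter `(1, 1)` has `sin θ = 0`, so its image is a focus-focus point and the value
    -- `(0, 1)` is attained.
    obtain ⟨h1, h2⟩ := fibreMap_mem hb (1, 1)
    exact ⟨_, h1, (isFocusFocusPoint_fibreMap_iff hb _).2 (by simp), h2⟩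

end Prolate

theorem mainTheorem7 (b : ℝ) (hb : 1 < b) :
    PoissonSystem.GeneratesCircleAction Prolate.structureMatrix Prolate.phaseSpace Prolate.ell23 ∧
    (∀ p ∈ Prolate.phaseSpace,
      PoissonSystem.IsSingular Prolate.structureMatrix Prolate.ell23 (Prolate.gPro b) p →
        PoissonSystem.IsNondegenerate Prolate.structureMatrix Prolate.ell23 (Prolate.gPro b) p ∧
        (PoissonSystem.IsEllipticPoint Prolate.structureMatrix Prolate.ell23 (Prolate.gPro b) p ∨
          PoissonSystem.IsFocusFocusPoint
            Prolate.structureMatrix Prolate.ell23 (Prolate.gPro b) p)) ∧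
    {c : ℝ × ℝ | ∃ p ∈ Prolate.phaseSpace,
      PoissonSystem.IsFocusFocusPoint Prolate.structureMatrix Prolate.ell23 (Prolate.gPro b) p ∧
        (Prolate.ell23 p, Prolate.gPro b p) = c} = {((0 : ℝ), (1 : ℝ))} ∧
    (∃ e : PoissonSystem.DoublyPinchedTorus ≃ₜ
        {p : PoissonSystem.Vec 6 // p ∈ Prolate.phaseSpace ∧
          (Prolate.ell23 p, Prolate.gPro b p) = ((0 : ℝ), (1 : ℝ))},
      ∀ x, PoissonSystem.IsFocusFocusPoint Prolate.structureMatrix Prolate.ell23 (Prolate.gPro b)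
        (e x : PoissonSystem.Vec 6) ↔ x ∈ PoissonSystem.pinchPoints) ∧
    PoissonSystem.IsGeneralisedSemitoric
      Prolate.structureMatrix Prolate.phaseSpace Prolate.ell23 (Prolate.gPro b) := by
  open PoissonSystem Prolate in
  refine ⟨generatesCircleAction_ell23, fun p hp h => singular_point hb hp h, focusFocus_values hb,
    ⟨fibreHomeomorph hb, ?_⟩, isGeneralisedSemitoric hb⟩
  rintro ⟨q⟩
  exact (Prolate.isFocusFocusPoint_fibreMap_iff hb q).trans (Prolate.mk_mem_pinchPoints_iff q).symm
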